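/- Let $k\ge 1$, $d,m$ be integers, $\varepsilon>0$, $B=\{t\in\mathbb R^d:\|t\|_2\le R\}$. For $\theta=(a_1,\dots,a_k,t_1,\dots,t_k)\in\mathbb R^{k(d+1)}$ put $\phi(\theta)=\sum_r a_r\delta_{t_r}$; let $\Sigma_{k,\eta}$ be the set of all $\phi(\theta)$ with $t_r\in B$ and $\|t_r-t_l\|_2>\eta$ for $r\ne l$, and let $\Theta_{k,\varepsilon}=\phi^{-1}(\Sigma_{k,\varepsilon})$. Let $\alpha_1,\dots,\alpha_m:B\to\mathbb C$ be of class $C^2$, $(Ax)_l=\int\alpha_l\,dx$, and $$D_{A,R}=\sup\{|\langle v,\nabla^2\alpha_l(t)w\rangle|:1\le l\le m,\ \|v\|_2=\|w\|_2=1,\ t\in B\}.$$ Let $h(s,t)=\rho(\|s-t\|_2)$ be a kernel on $\mathbb R^d$ with $\langle x,x'\rangle_h=\iint h\,dx\,dx'$ and $\|x\|_h^2=\langle x,x\rangle_h$. An $\eta$-dipole is a measure $a\delta_s-b\delta_t$ with $\|s-t\|_2\le\eta$; two $\eta$-dipoles are $\eta$-separated if each point of one is at distance $>\eta$ from each point of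 the other; $h$ has mutual coherence constant $\mu$ on $\eta$-separated dipoles if $\langle\nu_1,\nu_2\rangle_h\le\mu\|\nu_1\|_h\|\nu_2\|_h$ for all such pairs. Assume: $h$ and $\rho$ are $C^2$; $\rho(0)=1=\max|h|$, $\rho'(0)=0$, $\rho''(0)<0$; $0<c_h\le\varepsilon/2$ and $\rho(t)\ge 1-\frac{|\rho''(0)|}{2}t^2$ for $t\in[0,c_h]$; $h$ has some finite mutual coherence constant on $\varepsilon$-separated dipoles, and mutual coherence constant $\mu$ on $\frac\varepsilon2$-separated dipoles, with $(k-1)\mu<1$. Assume that $A$ has the restricted isometry property with constant $\gamma<1$: $$(1-\gamma)\|x\|_h^2\le\|Ax\|_2^2\le(1+\gamma)\|x\|_h^2\quad\text{for all }x\in\Sigma_{k,\varepsilon/2}-\Sigma_{k,\varepsilon/2}.$$ Let $y=Ax_0+e$ with $x_0\in\Sigma_{k,\varepsilon}$ and $e\in\mathbb C^m$, let $g(\theta)=\|A\phi(\theta)-y\|_2^2$, and let $\theta^*=(a_1,\dots,a_k,t_1,\dots,t_k)$ be a minimizer of $g$ over $\Theta_{k,\varepsilon}$ whose positions $t_r$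 are pairwise distinct and lie in the relative interior of $B$, and whose amplitudes satisfy $0<|a_1|\le\dots\le|a_k|$. Write $a^*=(a_1,\dots,a_k)$, $\beta_{\max}=\min\left(c_h,\frac{|a_1|}2,C_1C_3\right)$, where $$C_1=\frac{(1-\gamma)(1-(k-1)\mu)}{(d+1)\sqrt{1+\gamma}\sqrt{1+(k-1)\mu}},\qquad C_3=\frac{\min(1,|a_1|^2|\rho''(0)|/4)}{\max\left(|a_k|\sqrt m\,D_{A,R},\sqrt{1+\gamma}\sqrt{|\rho''(0)|}\right)\left(1+\sqrt{1+2|\rho''(0)|\,\|a^*\|_2^2}\right)},$$ and $\Lambda=\{\theta\in\mathbb R^{k(d+1)}:\|\theta-\theta^*\|_2<\beta_{\max}\}$. Suppose that all positions of all $\theta\in\Lambda$ lie in $B$ (so that $g$ is defined on $\Lambda$) and that $\|e\|_2\le\sqrt{1+\gamma}\sqrt{1+(k-1)\mu}\,\beta_{\max}$. Then $\Lambda$ is a basin of attraction of $\theta^*$: $\theta^*\in\Lambda$, and there is a step $\tau>0$ such that for every $\theta_0\in\Lambda$ the gradient descent $\theta_{n+1}=\theta_n-\tau\nabla g(\theta_n)$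 converges to $\theta^*$. -/

import Mathlib

open Filter Topology

noncomputable section

namespace Spikes

/-- Positions: `ℝ^d` with its Euclidean norm. -/
abbrev Pos (d : ℕ) : Type := EuclideanSpace ℝ (Fin d)

/-- Finite real combinations of Dirac measures on `ℝ^d`: the coefficient of `t` is the mass at `t`,
so that `Finsupp.single t a` is `a δ_t`. -/
abbrev SpikeMeasure (d : ℕ) : Type := Pos d →₀ ℝ

/-- The parameter space `ℝ^{k(d+1)}` with its Euclidean norm: `k` amplitudes and `k` positions
in `ℝ^d`. -/
abbrev Param (k d : ℕ) : Type := EuclideanSpace ℝ (Fin k ⊕ (Fin k × Fin d))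

variable {k d m : ℕ}

/-- The amplitude `a_r` of `θ = (a_1, …, a_k, t_1, …, t_k)`. -/
def amp (θ : Param k d) (r : Fin k) : ℝ := θ (Sum.inl r)

/-- The position `t_r` of `θ = (a_1, …, a_k, t_1, …, t_k)`. -/
def pos (θ : Param k d) (r : Fin k) : Pos d := WithLp.toLp 2 (fun j => θ (Sum.inr (r, j)))

/-- `φ(θ) = ∑_r a_r δ_{t_r}`. -/
def phi (θ : Param k d) : SpikeMeasure d := ∑ r, Finsupp.single (pos θ r) (amp θ r)

/-- The model set `Σ_{k,ε}`: sums of `k` Diracs whose positions are strictly `ε`-separated and lie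
in the closed ball of radius `R` about the origin. -/
def Model (k : ℕ) (d : ℕ) (R ε : ℝ) : Set (SpikeMeasure d) :=
  {x | ∃ θ : Param k d, (∀ r l, r ≠ l → ε < ‖pos θ r - pos θ l‖) ∧
    (∀ r, pos θ r ∈ Metric.closedBall (0 : Pos d) R) ∧ x = phi θ}

/-- `Θ_{k,ε} = φ⁻¹(Σ_{k,ε})`. -/
def ParamModel (k : ℕ) (d : ℕ) (R ε : ℝ) : Set (Param k d) := phi ⁻¹' Model k d R ε

/-- The measurement operator `(A x)_l = ∫ α_l dx`, on combinations of Diracs. -/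
def measOp (α : Fin m → Pos d → ℂ) : SpikeMeasure d →ₗ[ℝ] EuclideanSpace ℂ (Fin m) :=
  Finsupp.linearCombination ℝ (fun t => WithLp.toLp 2 (fun l => α l t))

/-- The objective `g(θ) = ‖A φ(θ) - y‖₂²`. -/
def objective (α : Fin m → Pos d → ℂ) (y : EuclideanSpace ℂ (Fin m)) (θ : Param k d) : ℝ :=
  ‖measOp α (phi θ) - y‖ ^ 2

/-- The translation invariant, radial kernel `h(s, t) = ρ(‖s - t‖)`. -/
def kernel (ρ : ℝ → ℝ) (s t : Pos d) : ℝ := ρ ‖s - t‖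

/-- `⟨x, y⟩_h = ∬ h(s, t) dx(s) dy(t)`, on combinations of Diracs. -/
def hInner (ρ : ℝ → ℝ) (x y : SpikeMeasure d) : ℝ :=
  x.sum fun s a => y.sum fun t b => a * b * kernel ρ s t

/-- `‖x‖_h = √⟨x, x⟩_h`. -/
def hNorm (ρ : ℝ → ℝ) (x : SpikeMeasure d) : ℝ := Real.sqrt (hInner ρ x x)

/-- The measure `a δ_s - b δ_t`; it is an `η`-dipole when `‖s - t‖ ≤ η`. -/
def dipole (a b : ℝ) (s t : Pos d) : SpikeMeasure d := Finsupp.single s a - Finsupp.single t b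

/-- The kernel has mutual coherence constant `μ` on `η`-separated (`η`-)dipoles of `ℝ^d`. -/
def MutualCoherence (d : ℕ) (ρ : ℝ → ℝ) (η μ : ℝ) : Prop :=
  ∀ (a₁ a₂ a₃ a₄ : ℝ) (t₁ t₂ t₃ t₄ : Pos d),
    ‖t₁ - t₂‖ ≤ η → ‖t₃ - t₄‖ ≤ η →
    η < ‖t₁ - t₃‖ → η < ‖t₂ - t₃‖ → η < ‖t₁ - t₄‖ → η < ‖t₂ - t₄‖ →
    hInner ρ (dipole a₁ a₂ t₁ t₂) (dipole a₃ a₄ t₃ t₄) ≤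
      μ * hNorm ρ (dipole a₁ a₂ t₁ t₂) * hNorm ρ (dipole a₃ a₄ t₃ t₄)

/-- The standing assumption on the kernel `h(s, t) = ρ(‖s - t‖)` at separation scale `ε`, with
quadratic lower bound on `[0, c]`. -/
structure KernelAssumption (d : ℕ) (ρ : ℝ → ℝ) (ε c : ℝ) : Prop where
  smooth_kernel : ContDiff ℝ 2 (fun p : Pos d × Pos d => kernel ρ p.1 p.2)
  smooth_profile : ContDiff ℝ 2 ρ
  value_zero : ρ 0 = 1
  abs_le_one : ∀ s t : Pos d, |kernel ρ s t| ≤ 1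
  deriv_zero : deriv ρ 0 = 0
  deriv2_neg : iteratedDeriv 2 ρ 0 < 0
  c_pos : 0 < c
  c_le : c ≤ ε / 2
  quadratic : ∀ t ∈ Set.Icc 0 c, 1 - |iteratedDeriv 2 ρ 0| / 2 * t ^ 2 ≤ ρ t
  coherence : ∃ μ : ℝ, MutualCoherence d ρ ε μ

/-- The restricted isometry property of `A` on `S - S` with respect to `‖·‖_h`, with constant
`γ`; the squared kernel norm is written as `⟨x, x⟩_h`. -/
def RIP (α : Fin m → Pos d → ℂ) (ρ : ℝ → ℝ) (S : Set (SpikeMeasure d)) (γ : ℝ) : Prop :=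
  ∀ x ∈ S, ∀ x' ∈ S,
    (1 - γ) * hInner ρ (x - x') (x - x') ≤ ‖measOp α (x - x')‖ ^ 2 ∧
    ‖measOp α (x - x')‖ ^ 2 ≤ (1 + γ) * hInner ρ (x - x') (x - x')

/-- `D_{A,R}`: the supremum of the second directional derivatives `|α_{l,v,w}''(t)|` over `l`,
unit vectors `v`, `w` and `t` in the closed ball of radius `R` (derivatives within that ball). -/
def derivBound (α : Fin m → Pos d → ℂ) (R : ℝ) : ℝ :=
  sSup {x : ℝ | ∃ (l : Fin m) (v w t : Pos d), ‖v‖ = 1 ∧ ‖w‖ = 1 ∧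
    t ∈ Metric.closedBall (0 : Pos d) R ∧
    x = ‖iteratedFDerivWithin ℝ 2 (α l) (Metric.closedBall (0 : Pos d) R) t ![v, w]‖}

/-- `C₁`. -/
def constC1 (k d : ℕ) (γ μ : ℝ) : ℝ :=
  ((1 - γ) * (1 - ((k : ℝ) - 1) * μ)) /
    (((d : ℝ) + 1) * Real.sqrt (1 + γ) * Real.sqrt (1 + ((k : ℝ) - 1) * μ))

/-- `C₃`, where `q` stands for `|ρ''(0)|`, `D` for `D_{A,R}`, `aMin` and `aMax` for the smallest
and the largest modulus of the amplitudes, and `normA` for the Euclidean norm of their vector. -/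
def constC3 (m : ℕ) (γ q D aMin aMax normA : ℝ) : ℝ :=
  min 1 (aMin ^ 2 * q / 4) /
    (max (aMax * Real.sqrt m * D) (Real.sqrt (1 + γ) * Real.sqrt q) *
      (1 + Real.sqrt (1 + 2 * q * normA ^ 2)))

/-- `β_max = min(c_h, |a_1|/2, C₁ C₃)` at the parameter `θ`, whose first amplitude is the one of
smallest modulus and whose last amplitude is the one of largest modulus. -/
def betaMax (hk : 0 < k) (α : Fin m → Pos d → ℂ) (R : ℝ) (ρ : ℝ → ℝ) (c γ μ : ℝ)
    (θ : Param k d) : ℝ :=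
  min c (min (|amp θ ⟨0, hk⟩| / 2)
    (constC1 k d γ μ *
      constC3 m γ |iteratedDeriv 2 ρ 0| (derivBound α R) |amp θ ⟨0, hk⟩|
        |amp θ ⟨k - 1, Nat.sub_lt hk Nat.one_pos⟩| (Real.sqrt (∑ r, amp θ r ^ 2))))

/-- `Λ` is a basin of attraction of `θ'` for `f`: `θ' ∈ Λ`, and for some step `τ > 0` the fixed
step gradient descent started at any point of `Λ` converges to `θ'`. -/
def IsBasinOfAttraction (f : Param k d → ℝ) (Λ : Set (Param k d)) (θ' : Param k d) : Prop :=
  θ' ∈ Λ ∧ ∃ τ : ℝ, 0 < τ ∧ ∀ θ₀ ∈ Λ,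
    Tendsto (fun n : ℕ => (fun θ => θ - τ • gradient f θ)^[n] θ₀) atTop (𝓝 θ')

end Spikes

end

open Spikes

/-! Gradient descent converges on a ball around a critical point when the Hessian is bounded above
there and, on every smaller concentric closed ball, bounded below by a positive constant: for a
small step, `z ↦ z - τ ∇g(z)` then contracts distances to the center
(`exists_step_gradient_descent_tendsto`). The theorem thus amounts to a Hessian estimate on `Λ`.

Formally the Hessian in direction `u` is twice the squared norm of the derivative of `A ∘ φ` along
`u`, plus twice the real inner product of the residual with the second derivative of `A ∘ φ`. For
the first part, `φ(θ + hu) - φ(θ)` is a sum of `k` mutually separated dipoles. RIP passes from `A`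
to the kernel norm, coherence makes the dipoles almost orthogonal, and `ρ''(0)` evaluates each of
them as `h → 0`. The second part costs the residual norm times a bound built from `D_{A,R}` and the
upper RIP inequality. Working with second difference quotients keeps all estimates on finite sums of
Diracs, where RIP is available, and only the final inequality passes to the limit
(`le_snd_fderiv_objective`).

The residual is at most `‖Aφ(θ) - Aφ(θ*)‖ + ‖e‖`, since minimality bounds the residual at `θ*` by
`‖e‖`; both terms are controlled by `β_max` (`norm_measOp_phi_sub_le`). The constants `C₁`, `C₃` are
those for which the lower bound stays positive strictly inside `Λ`.

RIP and coherence at scale `ε/2` also require `ε/2`-separated positions throughout `Λ`, that is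
`β_max ≤ ε/4`. When `k ≥ 2` this is forced by RIP itself (`radius_le_quarter`). -/

/-! ### Second difference quotients and their limits. -/

theorem tendsto_second_difference {E F : Type*} [NormedAddCommGroup E] [NormedSpace ℝ E]
    [NormedAddCommGroup F] [NormedSpace ℝ F] {f : E → F} {x : E} (hf : ContDiffAt ℝ 2 f x) (v : E) :
    Tendsto (fun h : ℝ => (h ^ 2)⁻¹ • (f (x + h • v) + f (x - h • v) - (2 : ℝ) • f x)) (𝓝[≠] 0)
      (𝓝 (fderiv ℝ (fderiv ℝ f) x v v)) := by
  set D := fderiv ℝ (fderiv ℝ f) x with hD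
  have hfd : HasFDerivAt (fderiv ℝ f) D x :=
    ((hf.fderiv_right (m := 1) (by norm_num)).differentiableAt (by norm_num)).hasFDerivAt
  have hp : ∀ h : ℝ, HasDerivAt (fun h : ℝ => x + h • v) v h := fun h => by
    simpa using ((hasDerivAt_id h).smul_const v).const_add x
  have hm : ∀ h : ℝ, HasDerivAt (fun h : ℝ => x - h • v) (-v) h := fun h => by
    simpa using ((hasDerivAt_id h).smul_const v).const_sub x
  have hev : ∀ᶠ z in 𝓝 x, DifferentiableAt ℝ f z := by
    filter_upwards [hf.eventually (by simp)] with z hz using hz.differentiableAt (by norm_num)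
  have hcp : Tendsto (fun h : ℝ => x + h • v) (𝓝 0) (𝓝 x) := by
    simpa using (hp 0).continuousAt.tendsto
  have hcm : Tendsto (fun h : ℝ => x - h • v) (𝓝 0) (𝓝 x) := by
    simpa using (hm 0).continuousAt.tendsto
  obtain ⟨δ, hδ, hball⟩ := Metric.eventually_nhds_iff_ball.1 ((hcp.eventually hev).and
    (hcm.eventually hev))
  -- With the expected quadratic term subtracted, the function of `h` has derivative `o(h)`;
  -- integrating gives a remainder `o(h ^ 2)`.
  have hder : ∀ h ∈ Metric.ball (0 : ℝ) δ, HasDerivAt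
      (fun h : ℝ => f (x + h • v) + f (x - h • v) - h ^ 2 • D v v)
      (fderiv ℝ f (x + h • v) v + fderiv ℝ f (x - h • v) (-v) - (2 * h) • D v v) h := by
    intro h hh
    have h1 := (hball h hh).1.hasFDerivAt.comp_hasDerivAt h (hp h)
    have h2 := (hball h hh).2.hasFDerivAt.comp_hasDerivAt h (hm h)
    have h3 : HasDerivAt (fun h : ℝ => h ^ 2 • D v v) ((2 * h) • D v v) h := by
      simpa using ((hasDerivAt_pow 2 h).smul_const (D v v))
    exact (h1.add h2).sub h3
  have hder0 : HasDerivAt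
      (fun h : ℝ => fderiv ℝ f (x + h • v) v + fderiv ℝ f (x - h • v) (-v) - (2 * h) • D v v)
      0 0 := by
    have e1 : HasFDerivAt (fderiv ℝ f) D (x + (0 : ℝ) • v) := by simpa using hfd
    have e2 : HasFDerivAt (fderiv ℝ f) D (x - (0 : ℝ) • v) := by simpa using hfd
    have h1 : HasDerivAt (fun h : ℝ => fderiv ℝ f (x + h • v)) (D v) 0 :=
      HasFDerivAt.comp_hasDerivAt (l := fderiv ℝ f) (f := fun h : ℝ => x + h • v) 0 e1 (hp 0)
    have h2 : HasDerivAt (fun h : ℝ => fderiv ℝ f (x - h • v)) (D (-v)) 0 :=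
      HasFDerivAt.comp_hasDerivAt (l := fderiv ℝ f) (f := fun h : ℝ => x - h • v) 0 e2 (hm 0)
    have h1' := h1.clm_apply (hasDerivAt_const (0 : ℝ) v)
    have h2' := h2.clm_apply (hasDerivAt_const (0 : ℝ) (-v))
    have h3 : HasDerivAt (fun h : ℝ => (2 * h) • D v v) ((2 : ℝ) • D v v) 0 := by
      simpa using (((hasDerivAt_id (0 : ℝ)).const_mul 2).smul_const (D v v))
    convert! (h1'.add h2').sub h3 using 1
    simp [two_smul]
  have ho := (hasDerivAt_iff_isLittleO.1 hder0)
  simp only [zero_smul, add_zero, sub_zero, mul_zero, map_neg, add_neg_cancel, smul_zero] at ho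
  have key := (convex_ball (0 : ℝ) δ).isLittleO_pow_succ_real (n := 1) (Metric.mem_ball_self hδ)
    (fun h hh => (hder h hh).hasDerivWithinAt) (by
      rw [nhdsWithin_eq_nhds.2 (Metric.ball_mem_nhds _ hδ)]
      simpa using ho)
  rw [nhdsWithin_eq_nhds.2 (Metric.ball_mem_nhds _ hδ)] at key
  have key2 := (key.mono (nhdsWithin_le_nhds (s := {0}ᶜ)))
  have key3 := key2.tendsto_inv_smul_nhds_zero.add_const (D v v)
  rw [zero_add] at key3
  refine key3.congr' ?_
  filter_upwards [self_mem_nhdsWithin] with h hh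
  have hh : h ≠ 0 := hh
  simp only [zero_smul, add_zero, sub_zero, one_add_one_eq_two, zero_pow two_ne_zero]
  rw [← two_smul ℝ (f x), sub_right_comm, smul_sub _ _ (h ^ 2 • _), smul_smul,
    inv_mul_cancel₀ (pow_ne_zero 2 hh), one_smul, sub_add_cancel]

theorem tendsto_one_sub_comp_norm_smul {E : Type*} [NormedAddCommGroup E] [NormedSpace ℝ E]
    {ρ : ℝ → ℝ} (hρ : ContDiff ℝ 2 ρ) (h0 : ρ 0 = 1) (h1 : deriv ρ 0 = 0)
    (h2 : iteratedDeriv 2 ρ 0 < 0) (v : E) :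
    Tendsto (fun h : ℝ => (h ^ 2)⁻¹ * (1 - ρ ‖h • v‖)) (𝓝[≠] 0)
      (𝓝 (|iteratedDeriv 2 ρ 0| / 2 * ‖v‖ ^ 2)) := by
  set q := |iteratedDeriv 2 ρ 0| with hq
  have hq' : iteratedDeriv 2 ρ 0 = -q := by rw [hq, abs_of_neg h2, neg_neg]
  have ht := taylor_isLittleO_univ (x₀ := 0) (n := 2) hρ
  have hT : ∀ s, taylorWithinEval ρ 2 Set.univ 0 s = 1 - q / 2 * s ^ 2 := by
    intro s
    simp [taylor_within_apply, iteratedDerivWithin_univ, h0, hq', h1,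
      iteratedDeriv_one]
    ring
  simp only [hT, sub_zero] at ht
  have hlim : Tendsto (fun h : ℝ => ‖h • v‖) (𝓝[≠] 0) (𝓝 0) := by
    have : Continuous (fun h : ℝ => ‖h • v‖) := by fun_prop
    simpa using (this.tendsto 0).mono_left (nhdsWithin_le_nhds (s := {0}ᶜ))
  have hO : (fun h : ℝ => ‖h • v‖ ^ 2) =O[𝓝[≠] 0] fun h : ℝ => h ^ 2 := by
    refine Asymptotics.IsBigO.of_bound (‖v‖ ^ 2) (Eventually.of_forall fun h => le_of_eq ?_)
    simp [norm_smul, mul_pow, mul_comm]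
  have key := ((ht.comp_tendsto hlim).trans_isBigO hO).tendsto_inv_smul_nhds_zero.const_sub
    (q / 2 * ‖v‖ ^ 2)
  rw [sub_zero] at key
  refine key.congr' ?_
  filter_upwards [self_mem_nhdsWithin] with h hh
  have hh : h ≠ 0 := hh
  simp only [Function.comp_apply, norm_smul, smul_eq_mul, mul_pow, Real.norm_eq_abs, sq_abs]
  field_simp
  ring

/-! ### Contraction of gradient descent. -/

/-- Polarization: for symmetric `P`, `4⟨Pa, b⟩` is the difference of the quadratic form at `a + b`
and `a - b`, and the parallelogram law sums the two bounds. -/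
theorem norm_le_of_abs_inner_self_le {E : Type*} [NormedAddCommGroup E] [InnerProductSpace ℝ E]
    {P : E →L[ℝ] E} (hP : ∀ u w, inner ℝ (P u) w = inner ℝ (P w) u) {κ : ℝ} (hκ0 : 0 ≤ κ)
    (hκ : ∀ u, |inner ℝ (P u) u| ≤ κ * ‖u‖ ^ 2) : ‖P‖ ≤ κ := by
  have key : ∀ a b : E, ‖a‖ = 1 → ‖b‖ = 1 → inner ℝ (P a) b ≤ κ := by
    intro a b ha hb
    have h1 := (abs_le.1 (hκ (a + b))).2
    have h2 := (abs_le.1 (hκ (a - b))).1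
    have h3 := congrArg (κ * ·) (parallelogram_law_with_norm ℝ a b)
    simp only [map_add, map_sub, inner_add_left, inner_sub_left, inner_add_right,
      inner_sub_right, hP b a] at h1 h2
    simp only [ha, hb, mul_add] at h3
    linarith
  refine ContinuousLinearMap.opNorm_le_bound _ hκ0 fun u => ?_
  rcases eq_or_ne u 0 with rfl | hu
  · simp
  rcases eq_or_ne (P u) 0 with hw | hw
  · rw [hw, norm_zero]; positivity
  have hu' := norm_pos_iff.2 hu
  have hw' := norm_pos_iff.2 hw
  have h := key (‖u‖⁻¹ • u) (‖P u‖⁻¹ • P u) (by simp [norm_smul, hu'.ne'])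
    (by simp [norm_smul, hw'.ne'])
  rw [map_smul, inner_smul_left, inner_smul_right, real_inner_self_eq_norm_sq] at h
  simp only [conj_trivial] at h
  field_simp at h
  linarith

/-- The step depends only on `L`, whereas the contraction rate depends on the distance of the
starting point to `x`. This is why a lower bound degenerating at the boundary of the ball suffices.
-/
theorem exists_step_gradient_descent_tendsto {E : Type*} [NormedAddCommGroup E]
    [InnerProductSpace ℝ E] [CompleteSpace E] {g : E → ℝ} {x : E} {β L : ℝ}
    (hg : ContDiffOn ℝ 2 g (Metric.ball x β))
    (hL : ∀ z ∈ Metric.ball x β, ∀ u, fderiv ℝ (fderiv ℝ g) z u u ≤ L * ‖u‖ ^ 2)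
    (hpos : ∀ r < β, ∃ l > 0, ∀ z ∈ Metric.closedBall x r, ∀ u,
      l * ‖u‖ ^ 2 ≤ fderiv ℝ (fderiv ℝ g) z u u)
    (hx : fderiv ℝ g x = 0) :
    ∃ τ : ℝ, 0 < τ ∧ ∀ z ∈ Metric.ball x β,
      Tendsto (fun n : ℕ => (fun z => z - τ • gradient g z)^[n] z) atTop (𝓝 x) := by
  set τ : ℝ := (|L| + 1)⁻¹ with hτ
  have hτ0 : 0 < τ := by positivity
  have hτL : τ * L ≤ 1 := by
    rw [hτ, inv_mul_le_iff₀ (by positivity)]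
    linarith [le_abs_self L]
  refine ⟨τ, hτ0, fun z₀ hz₀ => ?_⟩
  set T : E → E := fun z => z - τ • gradient g z with hT
  set r := dist z₀ x with hr
  have hrβ : r < β := hz₀
  obtain ⟨l, hl, hpos⟩ := hpos r hrβ
  have hsub : Metric.closedBall x r ⊆ Metric.ball x β := Metric.closedBall_subset_ball hrβ
  -- Since `τ * L ≤ 1`, the form of `I - τH` is nonnegative; its upper bound is `1 - τ * l`.
  set κ : ℝ := max 0 (1 - τ * l) with hκ
  have hκ0 : 0 ≤ κ := le_max_left _ _
  have hκ1 : κ < 1 := max_lt one_pos (by nlinarith)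
  have hgrad : ∀ z, gradient g z = (InnerProductSpace.toDual ℝ E).symm (fderiv ℝ g z) := fun z => rfl
  have hCA : ∀ z ∈ Metric.closedBall x r, ContDiffAt ℝ 2 g z := fun z hz =>
    hg.contDiffAt (Metric.isOpen_ball.mem_nhds (hsub hz))
  let J : StrongDual ℝ E →L[ℝ] E := LinearMap.mkContinuous
    { toFun := (InnerProductSpace.toDual ℝ E).symm
      map_add' := map_add _
      map_smul' := fun c φ => by simp } 1 (fun φ => by simp)
  have hJg : ∀ φ, J φ = (InnerProductSpace.toDual ℝ E).symm φ := fun φ => rfl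
  have hJi : ∀ φ w, inner ℝ (J φ) w = φ w := fun φ w => by
    rw [hJg, InnerProductSpace.toDual_symm_apply]
  have hTd : ∀ z ∈ Metric.closedBall x r, HasFDerivAt T
      (ContinuousLinearMap.id ℝ E - τ • J.comp (fderiv ℝ (fderiv ℝ g) z)) z := by
    intro z hz
    have h1 : HasFDerivAt (fderiv ℝ g) (fderiv ℝ (fderiv ℝ g) z) z :=
      (((hCA z hz).fderiv_right (m := 1) (by norm_num)).differentiableAt (by norm_num)).hasFDerivAt
    have h2 : HasFDerivAt (gradient g) (J.comp (fderiv ℝ (fderiv ℝ g) z)) z :=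
      J.hasFDerivAt.comp z h1
    exact (hasFDerivAt_id z).sub (h2.const_smul τ)
  have hTn : ∀ z ∈ Metric.closedBall x r,
      ‖ContinuousLinearMap.id ℝ E - τ • J.comp (fderiv ℝ (fderiv ℝ g) z)‖ ≤ κ := by
    intro z hz
    have hsymm : IsSymmSndFDerivAt ℝ g z := (hCA z hz).isSymmSndFDerivAt (by simp)
    set H := fderiv ℝ (fderiv ℝ g) z with hH
    have hPi : ∀ u w, inner ℝ ((ContinuousLinearMap.id ℝ E - τ • J.comp H) u) w =
        inner ℝ u w - τ * H u w := fun u w => by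
      simp [inner_sub_left, inner_smul_left, hJi]
    refine norm_le_of_abs_inner_self_le (fun u w => ?_) hκ0 fun u => ?_
    · rw [hPi, hPi, real_inner_comm, hsymm.eq u w]
    · rw [hPi, real_inner_self_eq_norm_sq]
      have h1 := hL z (hsub hz) u
      have h2 := hpos z hz u
      have h3 : (1 - τ * l) * ‖u‖ ^ 2 ≤ κ * ‖u‖ ^ 2 := by gcongr; exact le_max_right _ _
      have h4 : τ * (H u u) ≤ τ * (L * ‖u‖ ^ 2) := by gcongr
      have h5 : τ * (l * ‖u‖ ^ 2) ≤ τ * (H u u) := by gcongr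
      have h6 : τ * L * ‖u‖ ^ 2 ≤ 1 * ‖u‖ ^ 2 := by gcongr
      have h7 : 0 ≤ κ * ‖u‖ ^ 2 := by positivity
      rw [abs_le]
      constructor <;> linarith
  have hTx : T x = x := by
    simp [hT, hgrad, hx]
  have hstep : ∀ z ∈ Metric.closedBall x r, ‖T z - x‖ ≤ κ * ‖z - x‖ := by
    intro z hz
    have h := (convex_closedBall x r).norm_image_sub_le_of_norm_hasFDerivWithin_le
      (fun z hz => (hTd z hz).hasFDerivWithinAt) hTn
      (Metric.mem_closedBall_self dist_nonneg) hz
    rwa [hTx] at h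
  have hiter : ∀ n : ℕ, ‖T^[n] z₀ - x‖ ≤ κ ^ n * r := by
    intro n
    induction n with
    | zero => simp [hr, dist_eq_norm]
    | succ n ih =>
      rw [Function.iterate_succ_apply']
      have hmem : T^[n] z₀ ∈ Metric.closedBall x r := by
        rw [mem_closedBall_iff_norm]
        exact ih.trans (mul_le_of_le_one_left dist_nonneg (pow_le_one₀ hκ0 hκ1.le))
      calc _ ≤ κ * ‖T^[n] z₀ - x‖ := hstep _ hmem
        _ ≤ κ * (κ ^ n * r) := by gcongr
        _ = _ := by ring
  rw [tendsto_iff_norm_sub_tendsto_zero]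
  refine squeeze_zero (fun n => norm_nonneg _) hiter ?_
  simpa using (tendsto_pow_atTop_nhds_zero_of_lt_one hκ0 hκ1).mul_const r

/-! ### The kernel form on separated dipoles. -/

namespace Spikes
variable {k d m : ℕ}

/-- The kernel inner product as a bilinear form. -/
noncomputable def hForm (ρ : ℝ → ℝ) : SpikeMeasure d →ₗ[ℝ] SpikeMeasure d →ₗ[ℝ] ℝ :=
  Finsupp.linearCombination ℝ fun s => Finsupp.linearCombination ℝ fun t => kernel ρ s t

theorem hInner_eq_hForm (ρ : ℝ → ℝ) (x y : SpikeMeasure d) : hInner ρ x y = hForm ρ x y := by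
  simp only [hInner, hForm, Finsupp.linearCombination_apply, Finsupp.sum, LinearMap.sum_apply,
    LinearMap.smul_apply, smul_eq_mul, Finset.mul_sum, mul_assoc]

theorem hForm_single_single (ρ : ℝ → ℝ) (s t : Pos d) (a b : ℝ) :
    hForm ρ (Finsupp.single s a) (Finsupp.single t b) = a * b * ρ ‖s - t‖ := by
  simp [hForm, kernel, mul_assoc]

theorem hInner_dipole_self {ρ : ℝ → ℝ} (h0 : ρ 0 = 1) (a b : ℝ) (s t : Pos d) :
    hInner ρ (dipole a b s t) (dipole a b s t) = (a - b) ^ 2 + 2 * a * b * (1 - ρ ‖s - t‖) := by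
  simp only [hInner_eq_hForm, dipole, map_sub, LinearMap.sub_apply, hForm_single_single, sub_self,
    norm_zero, h0, norm_sub_rev t s]
  ring

/-- Positive definiteness of the kernel is not assumed; on two points `|h| ≤ 1` is enough. -/
theorem hInner_dipole_self_nonneg {ρ : ℝ → ℝ} (h0 : ρ 0 = 1)
    (hle : ∀ s t : Pos d, |kernel ρ s t| ≤ 1) (a b : ℝ) (s t : Pos d) :
    0 ≤ hInner ρ (dipole a b s t) (dipole a b s t) := by
  rw [hInner_dipole_self h0]
  have h := abs_le.1 (hle s t)
  simp only [kernel] at h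
  nlinarith [sq_nonneg (a - b), sq_nonneg (a + b)]

theorem dipole_neg (a b : ℝ) (s t : Pos d) : dipole (-a) (-b) s t = -dipole a b s t := by
  rw [dipole, dipole, Finsupp.single_neg, Finsupp.single_neg]
  abel

theorem hNorm_dipole_neg (ρ : ℝ → ℝ) (a b : ℝ) (s t : Pos d) :
    hNorm ρ (dipole (-a) (-b) s t) = hNorm ρ (dipole a b s t) := by
  simp [hNorm, hInner_eq_hForm, dipole_neg]

/-- Negating one dipole keeps its norm and flips the inner product, so the one-sided definition is
two-sided. -/
theorem MutualCoherence.abs_hInner_le {ρ : ℝ → ℝ} {η μ : ℝ} (hμ : MutualCoherence d ρ η μ)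
    (a₁ a₂ a₃ a₄ : ℝ) {t₁ t₂ t₃ t₄ : Pos d} (h12 : ‖t₁ - t₂‖ ≤ η) (h34 : ‖t₃ - t₄‖ ≤ η)
    (h13 : η < ‖t₁ - t₃‖) (h23 : η < ‖t₂ - t₃‖) (h14 : η < ‖t₁ - t₄‖) (h24 : η < ‖t₂ - t₄‖) :
    |hInner ρ (dipole a₁ a₂ t₁ t₂) (dipole a₃ a₄ t₃ t₄)| ≤
      μ * hNorm ρ (dipole a₁ a₂ t₁ t₂) * hNorm ρ (dipole a₃ a₄ t₃ t₄) := by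
  have h1 := hμ a₁ a₂ a₃ a₄ t₁ t₂ t₃ t₄ h12 h34 h13 h23 h14 h24
  have h2 := hμ (-a₁) (-a₂) a₃ a₄ t₁ t₂ t₃ t₄ h12 h34 h13 h23 h14 h24
  rw [hNorm_dipole_neg, dipole_neg, hInner_eq_hForm, map_neg, LinearMap.neg_apply,
    ← hInner_eq_hForm] at h2
  exact abs_le.2 ⟨by linarith, h1⟩

theorem MutualCoherence.abs_profile_le {ρ : ℝ → ℝ} {η μ : ℝ} (hμ : MutualCoherence d ρ η μ)
    (h0 : ρ 0 = 1) (hη : 0 ≤ η) {s t : Pos d} (hst : η < ‖s - t‖) : |ρ ‖s - t‖| ≤ μ := by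
  -- A unit Dirac is the degenerate dipole `1·δ_s - 0·δ_s`.
  have h := hμ.abs_hInner_le 1 0 1 0 (t₁ := s) (t₂ := s) (t₃ := t) (t₄ := t) (by simpa) (by simpa)
    hst hst hst hst
  have hn : ∀ s : Pos d, hNorm ρ (dipole 1 0 s s) = 1 := fun s => by
    simp [hNorm, hInner_dipole_self h0]
  rw [hn, hn] at h
  simpa [hInner_eq_hForm, dipole, hForm_single_single] using h

/-- A Gershgorin-type bound: each off-diagonal term is at most `μ (N r + N l) / 2` by the
arithmetic-geometric mean inequality, and each index meets `k - 1` others. -/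
theorem MutualCoherence.abs_hInner_sum_sub_le {ρ : ℝ → ℝ} {η μ : ℝ}
    (hμ : MutualCoherence d ρ η μ) (h0 : ρ 0 = 1) (hle : ∀ s t : Pos d, |kernel ρ s t| ≤ 1)
    (hη : 0 ≤ η) (a b : Fin k → ℝ) {s t : Fin k → Pos d} (hst : ∀ r, ‖s r - t r‖ ≤ η)
    (hss : ∀ r l, r ≠ l → η < ‖s r - s l‖) (htt : ∀ r l, r ≠ l → η < ‖t r - t l‖)
    (hts : ∀ r l, r ≠ l → η < ‖s r - t l‖) :
    |hInner ρ (∑ r, dipole (a r) (b r) (s r) (t r)) (∑ r, dipole (a r) (b r) (s r) (t r)) -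
      ∑ r, hInner ρ (dipole (a r) (b r) (s r) (t r)) (dipole (a r) (b r) (s r) (t r))| ≤
      ((k : ℝ) - 1) * μ *
        ∑ r, hInner ρ (dipole (a r) (b r) (s r) (t r)) (dipole (a r) (b r) (s r) (t r)) := by
  set ν := fun r => dipole (a r) (b r) (s r) (t r) with hν
  set N := fun r => hInner ρ (ν r) (ν r) with hN
  have hN0 : ∀ r, 0 ≤ N r := fun r => hInner_dipole_self_nonneg h0 hle _ _ _ _
  have hpair : ∀ r l, r ≠ l → |hInner ρ (ν r) (ν l)| ≤ μ * ((N r + N l) / 2) := by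
    intro r l hrl
    have h1 := hμ.abs_hInner_le (a r) (b r) (a l) (b l) (hst r) (hst l) (hss r l hrl)
      (by rw [norm_sub_rev]; exact hts l r hrl.symm) (hts r l hrl) (htt r l hrl)
    have hμ0 : 0 ≤ μ := (abs_nonneg _).trans (hμ.abs_profile_le h0 hη (hss r l hrl))
    refine h1.trans ?_
    rw [mul_assoc]
    refine mul_le_mul_of_nonneg_left ?_ hμ0
    have e1 : hNorm ρ (ν r) ^ 2 = N r := Real.sq_sqrt (hN0 r)
    have e2 : hNorm ρ (ν l) ^ 2 = N l := Real.sq_sqrt (hN0 l)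
    change hNorm ρ (ν r) * hNorm ρ (ν l) ≤ _
    nlinarith [sq_nonneg (hNorm ρ (ν r) - hNorm ρ (ν l))]
  have hexp : hInner ρ (∑ r, ν r) (∑ r, ν r) - ∑ r, N r =
      ∑ r, ∑ l ∈ Finset.univ.erase r, hInner ρ (ν r) (ν l) := by
    rw [hInner_eq_hForm]
    simp only [map_sum, LinearMap.sum_apply, ← hInner_eq_hForm]
    rw [Finset.sum_comm, ← Finset.sum_sub_distrib]
    refine Finset.sum_congr rfl fun r _ => ?_
    rw [← Finset.add_sum_erase _ _ (Finset.mem_univ r)]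
    simp only [hN]
    ring
  change |hInner ρ (∑ r, ν r) (∑ r, ν r) - ∑ r, N r| ≤ ((k : ℝ) - 1) * μ * ∑ r, N r
  rw [hexp]
  calc |∑ r, ∑ l ∈ Finset.univ.erase r, hInner ρ (ν r) (ν l)|
      ≤ ∑ r, ∑ l ∈ Finset.univ.erase r, μ * ((N r + N l) / 2) := by
        refine (Finset.abs_sum_le_sum_abs _ _).trans (Finset.sum_le_sum fun r _ => ?_)
        refine (Finset.abs_sum_le_sum_abs _ _).trans (Finset.sum_le_sum fun l hl => ?_)
        exact hpair r l (Finset.ne_of_mem_erase hl).symm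
    _ = ((k : ℝ) - 1) * μ * ∑ r, N r := by
        have h1 : ∀ r : Fin k, ∑ l ∈ Finset.univ.erase r, μ * ((N r + N l) / 2) =
            μ / 2 * (((k : ℝ) - 2) * N r + ∑ l, N l) := by
          intro r
          rw [← Finset.mul_sum, ← Finset.sum_div, Finset.sum_add_distrib, Finset.sum_const,
            Finset.card_erase_of_mem (Finset.mem_univ r), Finset.card_univ, Fintype.card_fin,
            ← Finset.add_sum_erase _ N (Finset.mem_univ r), nsmul_eq_mul,
            Nat.cast_sub (Nat.one_le_of_lt r.2)]
          push_cast
          ring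
        simp only [h1]
        rw [← Finset.mul_sum, Finset.sum_add_distrib, ← Finset.mul_sum, Finset.sum_const,
          Finset.card_univ, Fintype.card_fin, nsmul_eq_mul]
        ring

theorem MutualCoherence.hInner_sum_le {ρ : ℝ → ℝ} {η μ : ℝ}
    (hμ : MutualCoherence d ρ η μ) (h0 : ρ 0 = 1) (hle : ∀ s t : Pos d, |kernel ρ s t| ≤ 1)
    (hη : 0 ≤ η) (a b : Fin k → ℝ) {s t : Fin k → Pos d} (hst : ∀ r, ‖s r - t r‖ ≤ η)
    (hss : ∀ r l, r ≠ l → η < ‖s r - s l‖) (htt : ∀ r l, r ≠ l → η < ‖t r - t l‖)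
    (hts : ∀ r l, r ≠ l → η < ‖s r - t l‖) :
    hInner ρ (∑ r, dipole (a r) (b r) (s r) (t r)) (∑ r, dipole (a r) (b r) (s r) (t r)) ≤
      (1 + ((k : ℝ) - 1) * μ) *
        ∑ r, ((a r - b r) ^ 2 + 2 * a r * b r * (1 - ρ ‖s r - t r‖)) := by
  have h := (abs_le.1 (hμ.abs_hInner_sum_sub_le h0 hle hη a b hst hss htt hts)).2
  simp only [hInner_dipole_self h0] at h
  linarith

theorem MutualCoherence.le_hInner_sum {ρ : ℝ → ℝ} {η μ : ℝ}
    (hμ : MutualCoherence d ρ η μ) (h0 : ρ 0 = 1) (hle : ∀ s t : Pos d, |kernel ρ s t| ≤ 1)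
    (hη : 0 ≤ η) (a b : Fin k → ℝ) {s t : Fin k → Pos d} (hst : ∀ r, ‖s r - t r‖ ≤ η)
    (hss : ∀ r l, r ≠ l → η < ‖s r - s l‖) (htt : ∀ r l, r ≠ l → η < ‖t r - t l‖)
    (hts : ∀ r l, r ≠ l → η < ‖s r - t l‖) :
    (1 - ((k : ℝ) - 1) * μ) *
        ∑ r, ((a r - b r) ^ 2 + 2 * a r * b r * (1 - ρ ‖s r - t r‖)) ≤
      hInner ρ (∑ r, dipole (a r) (b r) (s r) (t r)) (∑ r, dipole (a r) (b r) (s r) (t r)) := by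
  have h := (abs_le.1 (hμ.abs_hInner_sum_sub_le h0 hle hη a b hst hss htt hts)).1
  simp only [hInner_dipole_self h0] at h
  linarith

/-! ### Coordinates on the parameter space and membership in the model. -/

/-- The parameter with amplitudes `a` and positions `t`. -/
noncomputable def mkParam (a : Fin k → ℝ) (t : Fin k → Pos d) : Param k d :=
  WithLp.toLp 2 (Sum.elim a fun p => t p.1 p.2)

@[simp] theorem amp_mkParam (a : Fin k → ℝ) (t : Fin k → Pos d) (r : Fin k) :
    amp (mkParam a t) r = a r := rfl

@[simp] theorem pos_mkParam (a : Fin k → ℝ) (t : Fin k → Pos d) (r : Fin k) :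
    pos (mkParam a t) r = t r := rfl

@[simp] theorem amp_add (θ u : Param k d) (r : Fin k) : amp (θ + u) r = amp θ r + amp u r := rfl
@[simp] theorem amp_sub (θ u : Param k d) (r : Fin k) : amp (θ - u) r = amp θ r - amp u r := rfl
@[simp] theorem amp_smul (h : ℝ) (u : Param k d) (r : Fin k) : amp (h • u) r = h * amp u r := rfl
@[simp] theorem pos_add (θ u : Param k d) (r : Fin k) : pos (θ + u) r = pos θ r + pos u r := rfl
@[simp] theorem pos_sub (θ u : Param k d) (r : Fin k) : pos (θ - u) r = pos θ r - pos u r := rfl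
@[simp] theorem pos_smul (h : ℝ) (u : Param k d) (r : Fin k) : pos (h • u) r = h • pos u r := rfl

theorem norm_sq_eq_sum (θ : Param k d) :
    ‖θ‖ ^ 2 = ∑ r, (amp θ r ^ 2 + ‖pos θ r‖ ^ 2) := by
  simp [EuclideanSpace.norm_sq_eq, amp, pos, Fintype.sum_prod_type, Finset.sum_add_distrib]

theorem abs_amp_le_norm (θ : Param k d) (r : Fin k) : |amp θ r| ≤ ‖θ‖ := by
  refine abs_le_of_sq_le_sq ?_ (norm_nonneg _)
  rw [norm_sq_eq_sum]
  refine le_trans ?_ (Finset.single_le_sum (f := fun r => amp θ r ^ 2 + ‖pos θ r‖ ^ 2)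
    (fun r _ => by positivity) (Finset.mem_univ r))
  linarith [sq_nonneg ‖pos θ r‖]

theorem norm_pos_le_norm (θ : Param k d) (r : Fin k) : ‖pos θ r‖ ≤ ‖θ‖ := by
  refine le_of_sq_le_sq ?_ (norm_nonneg _)
  rw [norm_sq_eq_sum]
  refine le_trans ?_ (Finset.single_le_sum (f := fun r => amp θ r ^ 2 + ‖pos θ r‖ ^ 2)
    (fun r _ => by positivity) (Finset.mem_univ r))
  linarith [sq_nonneg (amp θ r)]

theorem contDiff_amp {n : WithTop ℕ∞} (r : Fin k) :
    ContDiff ℝ n (fun θ : Param k d => amp θ r) := by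
  unfold amp
  fun_prop

theorem contDiff_pos {n : WithTop ℕ∞} (r : Fin k) :
    ContDiff ℝ n (fun θ : Param k d => pos θ r) := by
  rw [contDiff_euclidean]
  intro i
  simp only [pos]
  fun_prop

theorem continuous_pos (r : Fin k) : Continuous (fun θ : Param k d => pos θ r) :=
  (contDiff_pos (n := 0) r).continuous

theorem phi_sub_phi (θ θ' : Param k d) :
    phi θ - phi θ' = ∑ r, dipole (amp θ r) (amp θ' r) (pos θ r) (pos θ' r) := by
  simp [phi, dipole]

theorem phi_mem_model {R η : ℝ} {θ : Param k d}
    (hsep : ∀ r l, r ≠ l → η < ‖pos θ r - pos θ l‖)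
    (hball : ∀ r, pos θ r ∈ Metric.closedBall (0 : Pos d) R) : phi θ ∈ Model k d R η :=
  ⟨θ, hsep, hball, rfl⟩

/-- Membership only provides some separated `θ'` with the same measure. As the spikes of `θ` are
distinct and nonzero, each of its positions carries mass and so must be a position of `θ'`. -/
theorem separated_of_mem_paramModel {R η : ℝ} {θ : Param k d} (hθ : θ ∈ ParamModel k d R η)
    (hinj : Function.Injective (pos θ)) (hamp : ∀ r, amp θ r ≠ 0) (r l : Fin k) (hrl : r ≠ l) :
    η < ‖pos θ r - pos θ l‖ := by
  obtain ⟨θ', hsep, -, heq⟩ := hθ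
  have hσ : ∀ r, ∃ s, pos θ' s = pos θ r := by
    intro r
    by_contra! hcon
    have h1 : phi θ (pos θ r) = amp θ r := by
      rw [phi, Finsupp.finsetSum_apply, Finset.sum_eq_single r]
      · simp
      · intro s _ hs
        exact Finsupp.single_eq_of_ne (fun h => hs (hinj h.symm))
      · simp
    have h2 : phi θ' (pos θ r) = 0 := by
      rw [phi, Finsupp.finsetSum_apply]
      exact Finset.sum_eq_zero fun s _ => Finsupp.single_eq_of_ne (fun h => hcon s h.symm)
    rw [heq, h2] at h1
    exact hamp r h1.symm
  obtain ⟨s, hs⟩ := hσ r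
  obtain ⟨s', hs'⟩ := hσ l
  rw [← hs, ← hs']
  exact hsep s s' fun h => hrl (hinj (by rw [← hs, ← hs', h]))

/-- Zero amplitudes are allowed in the model, so RIP can be tested on fewer than `k` spikes, padded
by any separated positions. -/
theorem phi_mkParam_single (i : Fin k) (b : ℝ) (t : Fin k → Pos d) :
    phi (mkParam (Pi.single i b) t) = Finsupp.single (t i) b := by
  rw [phi, Finset.sum_eq_single i]
  · simp
  · intro r _ hr
    simp [Pi.single_eq_of_ne hr]
  · simp

theorem phi_mkParam_add (a b : Fin k → ℝ) (t : Fin k → Pos d) :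
    phi (mkParam (a + b) t) = phi (mkParam a t) + phi (mkParam b t) := by
  simp [phi, Finset.sum_add_distrib]

theorem phi_mkParam_zero (t : Fin k → Pos d) : phi (mkParam 0 t) = 0 := by
  simp [phi]

/-! ### Constraints that RIP puts on the constants. -/

theorem RIP.nonneg {α : Fin m → Pos d → ℂ} {ρ : ℝ → ℝ} {R η γ : ℝ}
    (h : RIP α ρ (Model k d R η) γ) (h0 : ρ 0 = 1) {t : Fin k → Pos d}
    (hsep : ∀ r l, r ≠ l → η < ‖t r - t l‖)
    (hball : ∀ r, t r ∈ Metric.closedBall (0 : Pos d) R) (i : Fin k) : 0 ≤ γ := by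
  have := h (phi (mkParam (Pi.single i 1) t)) (phi_mem_model hsep hball) (phi (mkParam 0 t))
    (phi_mem_model hsep hball)
  rw [phi_mkParam_single, phi_mkParam_zero, sub_zero, hInner_eq_hForm, hForm_single_single, sub_self,
    norm_zero, h0] at this
  linarith [this.1, this.2]

theorem separated_update {ι : Type*} [DecidableEq ι] {η : ℝ} {t : ι → Pos d}
    (hsep : ∀ r l, r ≠ l → η < ‖t r - t l‖) (i : ι) {p : Pos d}
    (hp : ∀ l, l ≠ i → η < ‖p - t l‖) (r l : ι) (hrl : r ≠ l) :
    η < ‖Function.update t i p r - Function.update t i p l‖ := by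
  rcases eq_or_ne r i with rfl | hr
  · rw [Function.update_self, Function.update_of_ne hrl.symm]
    exact hp l hrl.symm
  · rw [Function.update_of_ne hr]
    rcases eq_or_ne l i with rfl | hl
    · rw [Function.update_self, norm_sub_rev]
      exact hp r hr
    · rw [Function.update_of_ne hl]
      exact hsep r l hrl

/-- The upper RIP inequality makes the kernel form nonnegative on `δ_p + δ_{p+2tw} - 2δ_{p+tw}`,
which reads `4ρ(t) ≤ 3 + ρ(2t)`. For `t` just above `ε/4`, coherence gives `ρ(2t) ≤ μ`, and the
quadratic lower bound applies to `ρ(t)`. -/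
theorem one_sub_coherence_le {α : Fin m → Pos d → ℂ} {ρ : ℝ → ℝ} {R ε c μ γ : ℝ} (hε : 0 < ε)
    (hρ : KernelAssumption d ρ ε c) (hμ : MutualCoherence d ρ (ε / 2) μ)
    (hRIP : RIP α ρ (Model k d R (ε / 2)) γ) {s : Fin k → Pos d}
    (hsep : ∀ r l, r ≠ l → ε < ‖s r - s l‖)
    (hball : ∀ r, s r ∈ Metric.closedBall (0 : Pos d) R) {i j : Fin k} (hij : i ≠ j)
    (hc : ε / 4 < c) : 1 - μ ≤ |iteratedDeriv 2 ρ 0| * ε ^ 2 / 2 := by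
  set q := |iteratedDeriv 2 ρ 0| with hq
  have hγ0 : 0 ≤ γ := hRIP.nonneg hρ.value_zero (fun r l h => by linarith [hsep r l h]) hball i
  obtain ⟨t, ht1, ht2, ht3⟩ : ∃ t, ε / 4 < t ∧ t < c ∧
      ∀ r l, r ≠ l → 2 * t < ‖s r - s l‖ - ε / 2 := by
    have h1 : ∀ᶠ t in 𝓝[>] (ε / 4), ε / 4 < t := self_mem_nhdsWithin
    have h2 : ∀ᶠ t in 𝓝[>] (ε / 4), t < c :=
      nhdsWithin_le_nhds (gt_mem_nhds hc)
    have h3 : ∀ᶠ t in 𝓝[>] (ε / 4), ∀ r l, r ≠ l → 2 * t < ‖s r - s l‖ - ε / 2 := by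
      simp only [eventually_all]
      intro r l hrl
      have : ε / 4 < (‖s r - s l‖ - ε / 2) / 2 := by linarith [hsep r l hrl]
      filter_upwards [nhdsWithin_le_nhds (gt_mem_nhds this)] with t ht
      linarith
    exact (h1.and (h2.and h3)).exists
  have hcε := hρ.c_le
  set D := ‖s j - s i‖ with hD
  have hDε : ε < D := hsep j i hij.symm
  have hD0 : 0 < D := hε.trans hDε
  -- Moving towards another position stays in the ball by convexity.
  set w : Pos d := D⁻¹ • (s j - s i) with hw
  have hw1 : ‖w‖ = 1 := by
    rw [hw, norm_smul, norm_inv, norm_norm, ← hD, inv_mul_cancel₀ hD0.ne']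
  have hpd : ∀ τ τ' : ℝ, ‖(s i + τ • w) - (s i + τ' • w)‖ = |τ - τ'| := fun τ τ' => by
    rw [add_sub_add_left_eq_sub, ← sub_smul, norm_smul, hw1, mul_one, Real.norm_eq_abs]
  have hpball : ∀ τ : ℝ, 0 ≤ τ → τ ≤ D → s i + τ • w ∈ Metric.closedBall (0 : Pos d) R := by
    intro τ h0 h1
    have := (convex_closedBall (0 : Pos d) R).add_smul_sub_mem (hball i) (hball j)
      (t := τ * D⁻¹) ⟨by positivity, by rw [← div_eq_mul_inv, div_le_one hD0]; exact h1⟩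
    rwa [hw, smul_smul]
  have hpsep : ∀ τ : ℝ, 0 ≤ τ → τ ≤ 2 * t → ∀ l, l ≠ i → ε / 2 < ‖(s i + τ • w) - s l‖ := by
    intro τ h0 h1 l hl
    have h2 : ‖s i - s l‖ ≤ ‖(s i + τ • w) - s l‖ + ‖τ • w‖ := by
      have := norm_sub_le (s i + τ • w - s l) (τ • w)
      rwa [show s i + τ • w - s l - τ • w = s i - s l by abel] at this
    rw [norm_smul, hw1, mul_one, Real.norm_eq_abs, abs_of_nonneg h0] at h2
    linarith [ht3 i l hl.symm]
  have hsep' : ∀ r l, r ≠ l → ε / 2 < ‖s r - s l‖ := fun r l h => by linarith [hsep r l h]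
  -- Two separated configurations, one carrying `δ_p + δ_{p+2tw}` and the other `2δ_{p+tw}`.
  set s₁ := Function.update s j (s i + (2 * t) • w) with hs₁
  set s₂ := Function.update s i (s i + t • w) with hs₂
  have hi₁ : s₁ i = s i + (0 : ℝ) • w := by rw [hs₁, Function.update_of_ne hij]; simp
  have hj₁ : s₁ j = s i + (2 * t) • w := by rw [hs₁, Function.update_self]
  have hi₂ : s₂ i = s i + t • w := by rw [hs₂, Function.update_self]
  have hsep₁ : ∀ r l, r ≠ l → ε / 2 < ‖s₁ r - s₁ l‖ := by
    refine separated_update hsep' j fun l hl => ?_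
    rcases eq_or_ne l i with rfl | hli
    · have := hpd (2 * t) 0
      simp only [zero_smul, add_zero, sub_zero] at this
      rw [this, abs_of_pos (by linarith)]
      linarith
    · exact hpsep _ (by linarith) le_rfl l hli
  have hsep₂ : ∀ r l, r ≠ l → ε / 2 < ‖s₂ r - s₂ l‖ :=
    separated_update hsep' i (hpsep _ (by linarith) (by linarith))
  have hball₁ : ∀ r, s₁ r ∈ Metric.closedBall (0 : Pos d) R := by
    intro r
    rcases eq_or_ne r j with rfl | hr
    · rw [hj₁]; exact hpball _ (by linarith) (by linarith)
    · rw [hs₁, Function.update_of_ne hr]; exact hball r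
  have hball₂ : ∀ r, s₂ r ∈ Metric.closedBall (0 : Pos d) R := by
    intro r
    rcases eq_or_ne r i with rfl | hr
    · rw [hi₂]; exact hpball _ (by linarith) (by linarith)
    · rw [hs₂, Function.update_of_ne hr]; exact hball r
  have hrip := hRIP (phi (mkParam (Pi.single i 1 + Pi.single j 1) s₁)) (phi_mem_model hsep₁ hball₁)
    (phi (mkParam (Pi.single i 2) s₂)) (phi_mem_model hsep₂ hball₂)
  rw [phi_mkParam_add, phi_mkParam_single, phi_mkParam_single, phi_mkParam_single, hi₁, hj₁, hi₂]
    at hrip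
  have ht0 : 0 < t := by linarith
  have e1 : |2 * t - t| = t := by rw [abs_of_pos (by linarith)]; ring
  have e2 : |t - 2 * t| = t := by rw [abs_sub_comm, e1]
  simp only [hInner_eq_hForm, map_add, map_sub, LinearMap.add_apply, LinearMap.sub_apply,
    hForm_single_single, hpd, sub_self, norm_zero, hρ.value_zero, sub_zero, zero_sub, abs_neg, e1, e2,
    abs_of_pos ht0, abs_of_pos (show 0 < 2 * t by linarith)] at hrip
  have hnn : 4 * ρ t ≤ 3 + ρ (2 * t) := by
    have := nonneg_of_mul_nonneg_right ((sq_nonneg _).trans hrip.2) (by linarith)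
    linarith
  have hquad := hρ.quadratic t ⟨ht0.le, ht2.le⟩
  have hcoh : ρ (2 * t) ≤ μ := by
    have h1 := hμ.abs_profile_le hρ.value_zero (by linarith) (s := s i + (2 * t) • w)
      (t := s i + (0 : ℝ) • w) (by
        rw [hpd, sub_zero, abs_of_pos (by linarith)]; linarith)
    rw [hpd, sub_zero, abs_of_pos (show 0 < 2 * t by linarith)] at h1
    exact (abs_le.1 h1).2
  have hq0 : 0 ≤ q := abs_nonneg _
  have : q * (4 * t ^ 2) ≤ q * ε ^ 2 := mul_le_mul_of_nonneg_left (by nlinarith) hq0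
  linarith

end Spikes

/-! ### Smoothness and second derivatives of the measurements. -/

/-- Expanding both squares around `x`, the linear terms combine into an inner product of `x - y`
with the second difference; this is the discrete form of the splitting of the Hessian. -/
theorem le_norm_sq_second_difference {V : Type*} [NormedAddCommGroup V] [InnerProductSpace ℝ V]
    (p n x y : V) : ‖p - x‖ ^ 2 + ‖n - x‖ ^ 2 - 2 * (‖x - y‖ * ‖p + n - (2 : ℝ) • x‖) ≤
      ‖p - y‖ ^ 2 + ‖n - y‖ ^ 2 - 2 * ‖x - y‖ ^ 2 := by
  have h1 : ‖p - y‖ ^ 2 = ‖p - x‖ ^ 2 + 2 * inner ℝ (p - x) (x - y) + ‖x - y‖ ^ 2 := by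
    rw [← norm_add_sq_real, sub_add_sub_cancel]
  have h2 : ‖n - y‖ ^ 2 = ‖n - x‖ ^ 2 + 2 * inner ℝ (n - x) (x - y) + ‖x - y‖ ^ 2 := by
    rw [← norm_add_sq_real, sub_add_sub_cancel]
  have h3 : inner ℝ (p - x) (x - y) + inner ℝ (n - x) (x - y) =
      inner ℝ (p + n - (2 : ℝ) • x) (x - y) := by
    rw [← inner_add_left, two_smul]
    congr 1
    abel
  have h4 := (abs_le.1 (abs_real_inner_le_norm (p + n - (2 : ℝ) • x) (x - y))).1
  linarith

theorem exists_bound_snd_fderiv_of_contDiffOn {E F : Type*} [NormedAddCommGroup E]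
    [NormedSpace ℝ E] [NormedAddCommGroup F] [NormedSpace ℝ F] {f : E → F} {s : Set E}
    (hf : ContDiffOn ℝ 2 f s) (hc : IsCompact s) (hs : Convex ℝ s) (hne : (interior s).Nonempty) :
    ∃ C, ∀ x ∈ interior s, ∀ u, ‖fderiv ℝ (fderiv ℝ f) x u u‖ ≤ C * ‖u‖ ^ 2 := by
  obtain ⟨C, hC⟩ := hc.exists_bound_of_continuousOn
    (hf.continuousOn_iteratedFDerivWithin le_rfl (uniqueDiffOn_convex hs hne))
  refine ⟨C, fun x hx u => ?_⟩
  have h1 : iteratedFDerivWithin ℝ 2 f s x = iteratedFDeriv ℝ 2 f x := by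
    rw [← iteratedFDerivWithin_univ]
    exact iteratedFDerivWithin_congr_set
      (Filter.eventuallyEq_univ.mpr (mem_interior_iff_mem_nhds.1 hx)) 2
  have h2 := (iteratedFDerivWithin ℝ 2 f s x).le_of_opNorm_le (hC x (interior_subset hx)) ![u, u]
  rw [h1, iteratedFDeriv_two_apply] at h2
  simpa [Fin.prod_univ_two, pow_two] using h2

namespace Spikes
variable {k d m : ℕ}

/-- The measurements `(α_1(t), …, α_m(t))` of a unit spike at `t`. -/
noncomputable def measVec (α : Fin m → Pos d → ℂ) (t : Pos d) : EuclideanSpace ℂ (Fin m) :=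
  WithLp.toLp 2 fun l => α l t

theorem measOp_single (α : Fin m → Pos d → ℂ) (t : Pos d) (a : ℝ) :
    measOp α (Finsupp.single t a) = a • measVec α t := by
  simp [measOp, measVec]

theorem measOp_phi (α : Fin m → Pos d → ℂ) (θ : Param k d) :
    measOp α (phi θ) = ∑ r, amp θ r • measVec α (pos θ r) := by
  simp [phi, measOp_single]

theorem contDiffOn_measVec {α : Fin m → Pos d → ℂ} {B : Set (Pos d)}
    (hα : ∀ l, ContDiffOn ℝ 2 (α l) B) : ContDiffOn ℝ 2 (measVec α) B := by
  rw [contDiffOn_piLp]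
  exact hα

theorem contDiffOn_measOp_phi {α : Fin m → Pos d → ℂ} {B : Set (Pos d)}
    (hα : ∀ l, ContDiffOn ℝ 2 (α l) B) {s : Set (Param k d)} (hs : ∀ θ ∈ s, ∀ r, pos θ r ∈ B) :
    ContDiffOn ℝ 2 (fun θ : Param k d => measOp α (phi θ)) s := by
  simp only [measOp_phi]
  refine ContDiffOn.sum fun r _ => ?_
  exact (contDiff_amp r).contDiffOn.smul
    ((contDiffOn_measVec hα).comp (contDiff_pos r).contDiffOn fun θ hθ => hs θ hθ r)

theorem contDiffOn_objective {α : Fin m → Pos d → ℂ} {B : Set (Pos d)}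
    (hα : ∀ l, ContDiffOn ℝ 2 (α l) B) (y : EuclideanSpace ℂ (Fin m)) {s : Set (Param k d)}
    (hs : ∀ θ ∈ s, ∀ r, pos θ r ∈ B) : ContDiffOn ℝ 2 (objective α y) s :=
  ((contDiffOn_measOp_phi hα hs).sub contDiffOn_const).norm_sq ℝ

theorem norm_le_sqrt_mul {C : ℝ} (hC : 0 ≤ C) (z : EuclideanSpace ℂ (Fin m))
    (h : ∀ l, ‖z l‖ ≤ C) : ‖z‖ ≤ Real.sqrt m * C := by
  refine le_of_sq_le_sq ?_ (by positivity)
  rw [EuclideanSpace.norm_sq_eq, mul_pow, Real.sq_sqrt (Nat.cast_nonneg _)]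
  calc ∑ l, ‖z l‖ ^ 2 ≤ ∑ _l : Fin m, C ^ 2 :=
        Finset.sum_le_sum fun l _ => pow_le_pow_left₀ (norm_nonneg _) (h l) 2
    _ = m * C ^ 2 := by simp

/-- Needed because `sSup` of an unbounded set of reals is `0`, which would make `derivBound`
meaningless. -/
theorem bddAbove_derivBound {α : Fin m → Pos d → ℂ} {R : ℝ}
    (hα : ∀ l, ContDiffOn ℝ 2 (α l) (Metric.closedBall (0 : Pos d) R))
    (hne : (interior (Metric.closedBall (0 : Pos d) R)).Nonempty) :
    BddAbove {x : ℝ | ∃ (l : Fin m) (v w t : Pos d), ‖v‖ = 1 ∧ ‖w‖ = 1 ∧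
      t ∈ Metric.closedBall (0 : Pos d) R ∧
      x = ‖iteratedFDerivWithin ℝ 2 (α l) (Metric.closedBall (0 : Pos d) R) t ![v, w]‖} := by
  have hC : ∀ l, ∃ C, ∀ t ∈ Metric.closedBall (0 : Pos d) R,
      ‖iteratedFDerivWithin ℝ 2 (α l) (Metric.closedBall (0 : Pos d) R) t‖ ≤ C := fun l =>
    (isCompact_closedBall _ _).exists_bound_of_continuousOn
      ((hα l).continuousOn_iteratedFDerivWithin le_rfl
        (uniqueDiffOn_convex (convex_closedBall _ _) hne))
  choose C hC using hC
  refine ⟨∑ l, |C l|, ?_⟩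
  rintro x ⟨l, v, w, t, hv, hw, ht, rfl⟩
  refine ((iteratedFDerivWithin ℝ 2 (α l) (Metric.closedBall (0 : Pos d) R) t).le_of_opNorm_le
    (hC l t ht) ![v, w]).trans ?_
  simp only [Fin.prod_univ_two, Matrix.cons_val_zero, Matrix.cons_val_one, hv, hw, mul_one]
  exact (le_abs_self _).trans (Finset.single_le_sum (f := fun l => |C l|)
    (fun _ _ => abs_nonneg _) (Finset.mem_univ l))

theorem derivBound_nonneg (α : Fin m → Pos d → ℂ) (R : ℝ) : 0 ≤ derivBound α R := by
  refine Real.sSup_nonneg ?_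
  rintro x ⟨l, v, w, t, -, -, -, rfl⟩
  exact norm_nonneg _

theorem norm_snd_fderiv_le_derivBound {α : Fin m → Pos d → ℂ} {R : ℝ}
    (hα : ∀ l, ContDiffOn ℝ 2 (α l) (Metric.closedBall (0 : Pos d) R)) {t : Pos d}
    (ht : Metric.closedBall (0 : Pos d) R ∈ 𝓝 t) (l : Fin m) (v : Pos d) :
    ‖fderiv ℝ (fderiv ℝ (α l)) t v v‖ ≤ derivBound α R * ‖v‖ ^ 2 := by
  rcases eq_or_ne v 0 with rfl | hv
  · simp
  have hv' := norm_pos_iff.2 hv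
  set e : Pos d := ‖v‖⁻¹ • v with he
  have he1 : ‖e‖ = 1 := by rw [he, norm_smul, norm_inv, norm_norm, inv_mul_cancel₀ hv'.ne']
  have hve : v = ‖v‖ • e := by rw [he, smul_smul, mul_inv_cancel₀ hv'.ne', one_smul]
  have h1 : iteratedFDerivWithin ℝ 2 (α l) (Metric.closedBall (0 : Pos d) R) t =
      iteratedFDeriv ℝ 2 (α l) t := by
    rw [← iteratedFDerivWithin_univ]
    exact iteratedFDerivWithin_congr_set (Filter.eventuallyEq_univ.mpr ht) 2
  have h2 : ‖fderiv ℝ (fderiv ℝ (α l)) t e e‖ ≤ derivBound α R := by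
    refine le_csSup (bddAbove_derivBound hα ⟨t, mem_interior_iff_mem_nhds.2 ht⟩)
      ⟨l, e, e, t, he1, he1, mem_of_mem_nhds ht, ?_⟩
    rw [h1, iteratedFDeriv_two_apply]
    rfl
  clear_value e
  rw [hve, map_smul, map_smul, smul_apply, smul_smul, norm_smul, norm_smul, he1,
    mul_one, norm_mul, norm_norm, ← pow_two, mul_comm]
  gcongr

theorem norm_snd_fderiv_measVec_le {α : Fin m → Pos d → ℂ} {R : ℝ}
    (hα : ∀ l, ContDiffOn ℝ 2 (α l) (Metric.closedBall (0 : Pos d) R)) {t : Pos d}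
    (ht : Metric.closedBall (0 : Pos d) R ∈ 𝓝 t) (v : Pos d) :
    ‖fderiv ℝ (fderiv ℝ (measVec α)) t v v‖ ≤ Real.sqrt m * (derivBound α R * ‖v‖ ^ 2) := by
  refine norm_le_sqrt_mul (mul_nonneg (derivBound_nonneg α R) (sq_nonneg _)) _ fun l => ?_
  -- Second derivatives commute with coordinates by uniqueness of the limit of second differences.
  have h1 := tendsto_second_difference ((contDiffOn_measVec hα).contDiffAt ht) v
  have h2 := ((EuclideanSpace.proj (𝕜 := ℂ) l).continuous.tendsto _).comp h1
  have h3 := tendsto_second_difference ((hα l).contDiffAt ht) v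
  have h4 : fderiv ℝ (fderiv ℝ (measVec α)) t v v l = fderiv ℝ (fderiv ℝ (α l)) t v v :=
    tendsto_nhds_unique h2 h3
  rw [h4]
  exact norm_snd_fderiv_le_derivBound hα ht l v

/-! ### Lower bound of the Hessian. -/

/-- The positions of `θ` are `η`-separated and lie in the closed ball of radius `R`. -/
def Admissible (R η : ℝ) (θ : Param k d) : Prop :=
  (∀ r l, r ≠ l → η < ‖pos θ r - pos θ l‖) ∧ ∀ r, pos θ r ∈ Metric.closedBall (0 : Pos d) R

theorem Admissible.phi_mem {R η : ℝ} {θ : Param k d} (h : Admissible R η θ) (a : Fin k → ℝ) :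
    phi (mkParam a (pos θ)) ∈ Model k d R η :=
  phi_mem_model h.1 h.2

theorem RIP.norm_measVec_sub_le {α : Fin m → Pos d → ℂ} {ρ : ℝ → ℝ} {R η γ : ℝ}
    (h : RIP α ρ (Model k d R η) γ) (h0 : ρ 0 = 1) {θ θ' : Param k d} (hθ : Admissible R η θ)
    (hθ' : Admissible R η θ') (r : Fin k) :
    ‖measVec α (pos θ r) - measVec α (pos θ' r)‖ ^ 2 ≤
      (1 + γ) * (2 * (1 - ρ ‖pos θ r - pos θ' r‖)) := by
  have := (h _ (hθ.phi_mem (Pi.single r 1)) _ (hθ'.phi_mem (Pi.single r 1))).2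
  rw [phi_mkParam_single, phi_mkParam_single, map_sub, measOp_single, measOp_single, one_smul,
    one_smul] at this
  change _ ≤ (1 + γ) * hInner ρ (dipole 1 1 (pos θ r) (pos θ' r)) (dipole 1 1 _ _) at this
  rw [hInner_dipole_self h0] at this
  simpa using this

theorem RIP.norm_measOp_sub_bounds {α : Fin m → Pos d → ℂ} {ρ : ℝ → ℝ} {R η γ : ℝ}
    (h : RIP α ρ (Model k d R η) γ) {θ θ' : Param k d} (hθ : Admissible R η θ)
    (hθ' : Admissible R η θ') :
    (1 - γ) * hInner ρ (phi θ - phi θ') (phi θ - phi θ') ≤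
        ‖measOp α (phi θ) - measOp α (phi θ')‖ ^ 2 ∧
      ‖measOp α (phi θ) - measOp α (phi θ')‖ ^ 2 ≤
        (1 + γ) * hInner ρ (phi θ - phi θ') (phi θ - phi θ') := by
  rw [← map_sub]
  exact h _ (phi_mem_model hθ.1 hθ.2) _ (phi_mem_model hθ'.1 hθ'.2)

theorem second_difference_measOp_phi (α : Fin m → Pos d → ℂ) (θ u : Param k d) (h : ℝ) :
    measOp α (phi (θ + h • u)) + measOp α (phi (θ - h • u)) - (2 : ℝ) • measOp α (phi θ) =
      ∑ r, (amp θ r • (measVec α (pos θ r + h • pos u r) + measVec α (pos θ r - h • pos u r) -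
          (2 : ℝ) • measVec α (pos θ r)) +
        (h * amp u r) • (measVec α (pos θ r + h • pos u r) -
          measVec α (pos θ r - h • pos u r))) := by
  simp only [measOp_phi, Finset.smul_sum]
  rw [← Finset.sum_add_distrib, ← Finset.sum_sub_distrib]
  refine Finset.sum_congr rfl fun r _ => ?_
  simp only [amp_add, amp_sub, amp_smul, pos_add, pos_sub, pos_smul]
  module

/-- Lower bound of the Hessian of the objective. -/
theorem le_snd_fderiv_objective {α : Fin m → Pos d → ℂ} {ρ : ℝ → ℝ} {R ε c μ γ : ℝ} (hε : 0 < ε)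
    (hα : ∀ l, ContDiffOn ℝ 2 (α l) (Metric.closedBall (0 : Pos d) R))
    (hρ : KernelAssumption d ρ ε c) (hμ : MutualCoherence d ρ (ε / 2) μ)
    (hRIP : RIP α ρ (Model k d R (ε / 2)) γ) (hγ0 : 0 ≤ γ) (hγ : γ < 1)
    (y : EuclideanSpace ℂ (Fin m)) {θ : Param k d}
    (hadm : ∀ᶠ θ' in 𝓝 θ, Admissible R (ε / 2) θ')
    (hball : ∀ r, Metric.closedBall (0 : Pos d) R ∈ 𝓝 (pos θ r)) (u : Param k d) :
    2 * ((1 - γ) * (1 - ((k : ℝ) - 1) * μ)) *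
        ∑ r, (amp u r ^ 2 + amp θ r ^ 2 * |iteratedDeriv 2 ρ 0| * ‖pos u r‖ ^ 2) -
      2 * ‖measOp α (phi θ) - y‖ *
        ∑ r, (|amp θ r| * (Real.sqrt m * (derivBound α R * ‖pos u r‖ ^ 2)) +
          |amp u r| * (2 * (Real.sqrt (1 + γ) * Real.sqrt |iteratedDeriv 2 ρ 0| * ‖pos u r‖))) ≤
      fderiv ℝ (fderiv ℝ (objective α y)) θ u u := by
  set q := |iteratedDeriv 2 ρ 0| with hq
  set F : Param k d → EuclideanSpace ℂ (Fin m) := fun θ => measOp α (phi θ) with hF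
  have hq0 : 0 ≤ q := abs_nonneg _
  have hCg : ContDiffAt ℝ 2 (objective α y) θ := by
    have hO : {θ' : Param k d | Admissible R (ε / 2) θ'} ∈ 𝓝 θ := hadm
    exact (contDiffOn_objective hα y (s := {θ' | Admissible R (ε / 2) θ'})
      fun θ' h => h.2).contDiffAt hO
  have hprof := fun v : Pos d => tendsto_one_sub_comp_norm_smul hρ.smooth_profile hρ.value_zero
    hρ.deriv_zero hρ.deriv2_neg v
  rw [← hq] at hprof
  set P := fun r => fderiv ℝ (fderiv ℝ (measVec α)) (pos θ r) (pos u r) (pos u r) with hP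
  have hlow : Tendsto (fun h : ℝ =>
      (1 - γ) * ((1 - ((k : ℝ) - 1) * μ) * ∑ r, (2 * amp u r ^ 2 +
        4 * amp θ r ^ 2 * ((h ^ 2)⁻¹ * (1 - ρ ‖h • pos u r‖)))) -
      2 * (‖F θ - y‖ * ∑ r, (|amp θ r| *
        ‖(h ^ 2)⁻¹ • (measVec α (pos θ r + h • pos u r) + measVec α (pos θ r - h • pos u r) -
          (2 : ℝ) • measVec α (pos θ r))‖ + |amp u r| *
        Real.sqrt ((1 + γ) * (2 * ((h ^ 2)⁻¹ * (1 - ρ ‖h • ((2 : ℝ) • pos u r)‖)))))))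
      (𝓝[≠] 0) (𝓝 (
      (1 - γ) * ((1 - ((k : ℝ) - 1) * μ) * ∑ r, (2 * amp u r ^ 2 +
        4 * amp θ r ^ 2 * (q / 2 * ‖pos u r‖ ^ 2))) -
      2 * (‖F θ - y‖ * ∑ r, (|amp θ r| * ‖P r‖ + |amp u r| *
        Real.sqrt ((1 + γ) * (2 * (q / 2 * ‖(2 : ℝ) • pos u r‖ ^ 2))))))) := by
    refine Tendsto.sub ?_ ?_
    · refine (Tendsto.const_mul _ (tendsto_finsetSum _ fun r _ => ?_)).const_mul _
      exact ((hprof _).const_mul _).const_add _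
    · refine (Tendsto.const_mul _ (tendsto_finsetSum _ fun r _ => ?_)).const_mul _
      refine ((tendsto_second_difference ((contDiffOn_measVec hα).contDiffAt (hball r))
        _).norm.const_mul _).add (Tendsto.const_mul _ ?_)
      exact (Real.continuous_sqrt.tendsto _).comp (((hprof _).const_mul 2).const_mul _)
  have hev : ∀ᶠ h : ℝ in 𝓝[≠] 0, Admissible R (ε / 2) (θ + h • u) ∧
      Admissible R (ε / 2) (θ - h • u) ∧ ∀ r, ‖h • pos u r‖ ≤ ε / 2 ∧
      (∀ l, r ≠ l → ε / 2 < ‖pos (θ + h • u) r - pos θ l‖) ∧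
      (∀ l, r ≠ l → ε / 2 < ‖pos (θ - h • u) r - pos θ l‖) := by
    refine Filter.Eventually.filter_mono nhdsWithin_le_nhds ?_
    have hc1 : ContinuousAt (fun h : ℝ => θ + h • u) 0 := by fun_prop
    have hc2 : ContinuousAt (fun h : ℝ => θ - h • u) 0 := by fun_prop
    have t1 : Tendsto (fun h : ℝ => θ + h • u) (𝓝 0) (𝓝 θ) := by simpa using hc1.tendsto
    have t2 : Tendsto (fun h : ℝ => θ - h • u) (𝓝 0) (𝓝 θ) := by simpa using hc2.tendsto
    have hsep : ∀ r l, r ≠ l → ∀ᶠ θ' in 𝓝 θ, ε / 2 < ‖pos θ' r - pos θ l‖ := by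
      intro r l hrl
      have hcont : ContinuousAt (fun θ' : Param k d => ‖pos θ' r - pos θ l‖) θ :=
        ((continuous_pos r).sub continuous_const).norm.continuousAt
      exact hcont.eventually_const_lt (hadm.self_of_nhds.1 r l hrl)
    refine (t1.eventually hadm).and ((t2.eventually hadm).and ?_)
    refine eventually_all.2 fun r => ?_
    refine Filter.Eventually.and ?_ (Filter.Eventually.and ?_ ?_)
    · have hcont : ContinuousAt (fun h : ℝ => ‖h • pos u r‖) 0 := by fun_prop
      exact (hcont.eventually_lt_const (by simpa using hε)).mono fun h => le_of_lt
    · exact eventually_all.2 fun l => eventually_all.2 fun hrl => t1.eventually (hsep r l hrl)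
    · exact eventually_all.2 fun l => eventually_all.2 fun hrl => t2.eventually (hsep r l hrl)
  have hmain := le_of_tendsto_of_tendsto hlow (tendsto_second_difference hCg u) (by
    filter_upwards [hev, self_mem_nhdsWithin] with h hh hh0
    obtain ⟨had1, had2, hh⟩ := hh
    have hh0 : h ≠ 0 := hh0
    have had := hadm.self_of_nhds
    have hε2 : 0 ≤ ε / 2 := by linarith
    have hpos_h : 0 < (h ^ 2)⁻¹ := by positivity
    -- Used for `σ = h` and `σ = -h`; in the sum the terms odd in `σ` cancel, leaving `4 * amp θ r ^
    -- 2`.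
    have low : ∀ σ : ℝ, (∀ r, ‖σ • pos u r‖ ≤ ε / 2) → Admissible R (ε / 2) (θ + σ • u) →
        (∀ r l, r ≠ l → ε / 2 < ‖pos (θ + σ • u) r - pos θ l‖) →
        (1 - γ) * ((1 - ((k : ℝ) - 1) * μ) * ∑ r, ((σ * amp u r) ^ 2 +
          2 * (amp θ r + σ * amp u r) * amp θ r * (1 - ρ ‖σ • pos u r‖))) ≤
        ‖F (θ + σ • u) - F θ‖ ^ 2 := by
      intro σ hσ hadσ hcross
      refine le_trans ?_ (hRIP.norm_measOp_sub_bounds hadσ had).1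
      refine mul_le_mul_of_nonneg_left ?_ (by linarith)
      rw [phi_sub_phi]
      have := hμ.le_hInner_sum hρ.value_zero hρ.abs_le_one hε2 (amp (θ + σ • u)) (amp θ)
        (s := pos (θ + σ • u)) (t := pos θ) (fun r => by simpa using hσ r) hadσ.1 had.1 hcross
      simpa using this
    have low1 := low h (fun r => (hh r).1) had1 fun r => (hh r).2.1
    have hneg : θ + (-h) • u = θ - h • u := by rw [neg_smul, sub_eq_add_neg]
    have low2 := low (-h) (fun r => by simpa using (hh r).1) (by rwa [hneg])
      (by rw [hneg]; exact fun r => (hh r).2.2)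
    rw [hneg] at low2
    have hsum : (1 - γ) * ((1 - ((k : ℝ) - 1) * μ) * ∑ r, (2 * amp u r ^ 2 +
        4 * amp θ r ^ 2 * ((h ^ 2)⁻¹ * (1 - ρ ‖h • pos u r‖)))) ≤
        (h ^ 2)⁻¹ * (‖F (θ + h • u) - F θ‖ ^ 2 + ‖F (θ - h • u) - F θ‖ ^ 2) := by
      refine le_trans (le_of_eq ?_) (mul_le_mul_of_nonneg_left (add_le_add low1 low2) hpos_h.le)
      rw [← mul_add, ← mul_add, ← Finset.sum_add_distrib, mul_left_comm (h ^ 2)⁻¹,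
        mul_left_comm (h ^ 2)⁻¹,
        Finset.mul_sum (a := (h ^ 2)⁻¹)]
      congr 2
      refine Finset.sum_congr rfl fun r _ => ?_
      rw [neg_smul, norm_neg]
      field_simp
      ring
    have hdiff : (h ^ 2)⁻¹ * ‖F (θ + h • u) + F (θ - h • u) - (2 : ℝ) • F θ‖ ≤
        ∑ r, (|amp θ r| *
        ‖(h ^ 2)⁻¹ • (measVec α (pos θ r + h • pos u r) + measVec α (pos θ r - h • pos u r) -
          (2 : ℝ) • measVec α (pos θ r))‖ + |amp u r| *
        Real.sqrt ((1 + γ) * (2 * ((h ^ 2)⁻¹ * (1 - ρ ‖h • ((2 : ℝ) • pos u r)‖))))) := by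
      rw [second_difference_measOp_phi]
      refine (mul_le_mul_of_nonneg_left (norm_sum_le _ _) hpos_h.le).trans ?_
      rw [Finset.mul_sum]
      refine Finset.sum_le_sum fun r _ => ?_
      refine (mul_le_mul_of_nonneg_left (norm_add_le _ _) hpos_h.le).trans ?_
      rw [mul_add]
      refine add_le_add (le_of_eq ?_) ?_
      · rw [norm_smul, norm_smul, Real.norm_eq_abs, Real.norm_eq_abs, abs_of_pos hpos_h]
        ring
      -- The mixed amplitude-position term is a first difference of measurements, so upper RIP on
      -- `δ_{t+hv} - δ_{t-hv}` bounds it without any bound on first derivatives of `α`.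
      · have hm := hRIP.norm_measVec_sub_le hρ.value_zero had1 had2 r
        simp only [pos_add, pos_sub, pos_smul] at hm
        rw [add_sub_sub_cancel, ← two_smul ℝ, smul_comm] at hm
        have h1 : |h|⁻¹ * ‖measVec α (pos θ r + h • pos u r) -
            measVec α (pos θ r - h • pos u r)‖ ≤
            Real.sqrt ((1 + γ) * (2 * ((h ^ 2)⁻¹ * (1 - ρ ‖h • ((2 : ℝ) • pos u r)‖)))) := by
          refine Real.le_sqrt_of_sq_le ?_
          rw [mul_pow, inv_pow, sq_abs]
          refine (mul_le_mul_of_nonneg_left hm hpos_h.le).trans (le_of_eq ?_)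
          ring
        refine le_trans (le_of_eq ?_) (mul_le_mul_of_nonneg_left h1 (abs_nonneg (amp u r)))
        rw [norm_smul, Real.norm_eq_abs, abs_mul, ← sq_abs h]
        have : |h| ≠ 0 := abs_ne_zero.2 hh0
        field_simp
    have key := mul_le_mul_of_nonneg_left
      (le_norm_sq_second_difference (F (θ + h • u)) (F (θ - h • u)) (F θ) y) hpos_h.le
    have hw := mul_le_mul_of_nonneg_left hdiff (norm_nonneg (F θ - y))
    have hobj : ∀ θ, objective α y θ = ‖F θ - y‖ ^ 2 := fun θ => rfl
    simp only [smul_eq_mul, hobj]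
    rw [mul_sub] at key
    linarith)
  refine le_trans ?_ hmain
  have hsq : ∀ r, Real.sqrt ((1 + γ) * (2 * (q / 2 * ‖(2 : ℝ) • pos u r‖ ^ 2))) =
      2 * (Real.sqrt (1 + γ) * Real.sqrt q * ‖pos u r‖) := by
    intro r
    rw [← Real.sqrt_mul (by linarith), norm_smul, Real.norm_two, Real.sqrt_eq_iff_mul_self_eq
      (by positivity) (by positivity)]
    have := Real.mul_self_sqrt (show 0 ≤ (1 + γ) * q by positivity)
    linear_combination -4 * ‖pos u r‖ ^ 2 * this
  have hPb : ∀ r, ‖P r‖ ≤ Real.sqrt m * (derivBound α R * ‖pos u r‖ ^ 2) := fun r =>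
    norm_snd_fderiv_measVec_le hα (hball r) (pos u r)
  simp only [hsq]
  have e1 : 2 * ((1 - γ) * (1 - ((k : ℝ) - 1) * μ)) *
      ∑ r, (amp u r ^ 2 + amp θ r ^ 2 * q * ‖pos u r‖ ^ 2) =
      (1 - γ) * ((1 - ((k : ℝ) - 1) * μ) * ∑ r, (2 * amp u r ^ 2 +
        4 * amp θ r ^ 2 * (q / 2 * ‖pos u r‖ ^ 2))) := by
    rw [mul_comm 2 ((1 - γ) * _), mul_assoc, mul_assoc, Finset.mul_sum (a := (2 : ℝ))]
    congr 2
    exact Finset.sum_congr rfl fun r _ => by ring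
  rw [e1, mul_assoc 2 ‖F θ - y‖]
  gcongr
  exact hPb _

/-! ### Estimates of the residual and of the two quadratic forms. -/

theorem MutualCoherence.one_le_one_add {ρ : ℝ → ℝ} {η μ : ℝ} (hμ : MutualCoherence d ρ η μ)
    (h0 : ρ 0 = 1) (hη : 0 ≤ η) (hk : 0 < k) {t : Fin k → Pos d}
    (hsep : ∀ r l, r ≠ l → η < ‖t r - t l‖) : 1 ≤ 1 + ((k : ℝ) - 1) * μ := by
  have hk1 : (1 : ℝ) ≤ k := by exact_mod_cast hk
  rcases (Nat.one_le_iff_ne_zero.2 hk.ne').eq_or_lt with h1 | h1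
  · simp [← h1]
  · have hμ0 : 0 ≤ μ := (abs_nonneg _).trans (hμ.abs_profile_le h0 hη
      (hsep ⟨0, hk⟩ ⟨1, h1⟩ (by simp)))
    nlinarith

theorem norm_measOp_phi_sub_le {α : Fin m → Pos d → ℂ} {ρ : ℝ → ℝ} {R ε c μ γ : ℝ}
    (hε : 0 < ε) (hρ : KernelAssumption d ρ ε c) (hμ : MutualCoherence d ρ (ε / 2) μ)
    (hRIP : RIP α ρ (Model k d R (ε / 2)) γ) (hγ0 : 0 ≤ γ) (hK : 1 ≤ 1 + ((k : ℝ) - 1) * μ)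
    {θ θ' : Param k d} (hθ : Admissible R (ε / 2) θ) (hθ' : Admissible R ε θ')
    (hpos : ∀ r, ‖pos θ r - pos θ' r‖ ≤ c)
    (hamp : ∀ r, |amp θ r - amp θ' r| ≤ |amp θ' r| / 2) :
    ‖measOp α (phi θ) - measOp α (phi θ')‖ ≤
      Real.sqrt (1 + γ) * Real.sqrt (1 + ((k : ℝ) - 1) * μ) *
        (Real.sqrt (1 + 2 * |iteratedDeriv 2 ρ 0| * Real.sqrt (∑ r, amp θ' r ^ 2) ^ 2) *
          ‖θ - θ'‖) := by
  set q := |iteratedDeriv 2 ρ 0| with hq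
  have hq0 : 0 ≤ q := abs_nonneg _
  have hθ2 : Admissible R (ε / 2) θ' := ⟨fun r l h => by linarith [hθ'.1 r l h], hθ'.2⟩
  rw [Real.sq_sqrt (Finset.sum_nonneg fun _ _ => sq_nonneg _)]
  set N := ∑ r, amp θ' r ^ 2 with hN
  have hN0 : 0 ≤ N := Finset.sum_nonneg fun _ _ => sq_nonneg _
  have hcε := hρ.c_le
  refine le_of_sq_le_sq ?_ (by positivity)
  rw [mul_pow, mul_pow, mul_pow, Real.sq_sqrt (by linarith), Real.sq_sqrt (by linarith),
    Real.sq_sqrt (by positivity), mul_assoc]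
  refine (hRIP.norm_measOp_sub_bounds hθ hθ2).2.trans
    (mul_le_mul_of_nonneg_left ?_ (by linarith))
  rw [phi_sub_phi]
  refine (hμ.hInner_sum_le hρ.value_zero hρ.abs_le_one (by linarith) _ _
    (fun r => (hpos r).trans hcε) hθ.1 hθ2.1 fun r l hrl => ?_).trans
    (mul_le_mul_of_nonneg_left ?_ (by linarith))
  -- Cross-separation: `ε` minus the displacement `c ≤ ε/2` still exceeds `ε/2`.
  · have h1 := norm_sub_le_norm_sub_add_norm_sub (pos θ' r) (pos θ r) (pos θ' l)
    rw [norm_sub_rev (pos θ' r) (pos θ r)] at h1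
    linarith [hθ'.1 r l hrl, hpos r]
  · rw [norm_sq_eq_sum, Finset.mul_sum]
    refine Finset.sum_le_sum fun r _ => ?_
    rw [amp_sub, pos_sub]
    have hNr : amp θ' r ^ 2 ≤ N := Finset.single_le_sum (f := fun r => amp θ' r ^ 2)
      (fun _ _ => sq_nonneg _) (Finset.mem_univ r)
    have hquad := hρ.quadratic _ ⟨norm_nonneg _, hpos r⟩
    set s := ‖pos θ r - pos θ' r‖ with hs
    set a := amp θ r
    set b := amp θ' r
    have hab : |(a - b) * b| ≤ b ^ 2 / 2 := by
      rw [abs_mul, ← sq_abs b]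
      nlinarith [hamp r, abs_nonneg b]
    have hab' := abs_le.1 hab
    have hab0 : 0 ≤ a * b := by nlinarith [sq_nonneg b]
    have hab1 : a * b ≤ 2 * N := by nlinarith
    have h1 : 2 * a * b * (1 - ρ s) ≤ 2 * (a * b) * (q / 2 * s ^ 2) := by
      rw [mul_assoc 2 a b]
      exact mul_le_mul_of_nonneg_left (by linarith) (by linarith)
    have h2 : a * b * (q * s ^ 2) ≤ 2 * N * (q * s ^ 2) :=
      mul_le_mul_of_nonneg_right hab1 (by positivity)
    have h3 : 0 ≤ q * N * (a - b) ^ 2 := by positivity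
    nlinarith [sq_nonneg s]

theorem sum_quadratic_lower {q a : ℝ} (hq : 0 ≤ q) {θ : Param k d}
    (ha : ∀ r, a / 2 ≤ |amp θ r|) (ha0 : 0 ≤ a) (u : Param k d) :
    min 1 (a ^ 2 * q / 4) * ‖u‖ ^ 2 ≤
      ∑ r, (amp u r ^ 2 + amp θ r ^ 2 * q * ‖pos u r‖ ^ 2) := by
  rw [norm_sq_eq_sum, Finset.mul_sum]
  refine Finset.sum_le_sum fun r _ => ?_
  rw [mul_add]
  refine add_le_add (mul_le_of_le_one_left (sq_nonneg _) (min_le_left _ _))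
    (mul_le_mul_of_nonneg_right ((min_le_right _ _).trans ?_) (sq_nonneg _))
  have : (a / 2) ^ 2 ≤ |amp θ r| ^ 2 := pow_le_pow_left₀ (by linarith) (ha r) 2
  rw [sq_abs] at this
  nlinarith

/-- For `d ≥ 1` the factor `d + 1 ≥ 2` suffices because `2(x² + w²) - (3/2)w² - 2xw = (w - 2x)²/2`.
For `d = 0` positions contribute nothing. -/
theorem sum_cross_upper {M D b P : ℝ} (hD : b * D ≤ M) (hD0 : 0 ≤ D) (hP : P ≤ M) (hP0 : 0 ≤ P)
    {θ : Param k d} (hb : ∀ r, |amp θ r| ≤ 3 / 2 * b) (u : Param k d) :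
    ∑ r, (|amp θ r| * (D * ‖pos u r‖ ^ 2) + |amp u r| * (2 * (P * ‖pos u r‖))) ≤
      ((d : ℝ) + 1) * M * ‖u‖ ^ 2 := by
  rw [norm_sq_eq_sum, Finset.mul_sum]
  refine Finset.sum_le_sum fun r _ => ?_
  have hM : 0 ≤ M := hP0.trans hP
  rcases Nat.eq_zero_or_pos d with rfl | hd
  · have : ‖pos u r‖ = 0 := by rw [Subsingleton.elim (pos u r) 0, norm_zero]
    rw [this]
    simp only [Nat.cast_zero]
    nlinarith [mul_nonneg hM (sq_nonneg (amp u r))]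
  · have hd1 : (1 : ℝ) ≤ d := by exact_mod_cast hd
    set w := ‖pos u r‖
    set x := |amp u r| with hx
    have hw : 0 ≤ w := norm_nonneg _
    have hx0 : 0 ≤ x := abs_nonneg _
    rw [← sq_abs (amp u r), ← hx]
    have h1 : |amp θ r| * (D * w ^ 2) ≤ 3 / 2 * M * w ^ 2 := by
      calc |amp θ r| * (D * w ^ 2) ≤ 3 / 2 * b * (D * w ^ 2) := by gcongr; exact hb r
        _ = 3 / 2 * (b * D) * w ^ 2 := by ring
        _ ≤ _ := by gcongr
    have h2 : x * (2 * (P * w)) ≤ 2 * M * (x * w) := by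
      calc x * (2 * (P * w)) = 2 * P * (x * w) := by ring
        _ ≤ _ := by gcongr
    have h3 : 2 * M * (x ^ 2 + w ^ 2) ≤ ((d : ℝ) + 1) * M * (x ^ 2 + w ^ 2) := by
      gcongr
      linarith
    nlinarith [mul_nonneg hM (sq_nonneg (w - 2 * x))]

/-- Each position can be moved alone inside the open set `U`, so it is interior to the ball and `α`
is `C²` around it. -/
theorem closedBall_mem_nhds_pos {R : ℝ} {U : Set (Param k d)} (hU : IsOpen U)
    (hball : ∀ θ ∈ U, ∀ r, pos θ r ∈ Metric.closedBall (0 : Pos d) R) {θ : Param k d} (hθ : θ ∈ U)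
    (r : Fin k) : Metric.closedBall (0 : Pos d) R ∈ 𝓝 (pos θ r) := by
  set f : Pos d → Param k d := fun p => θ + mkParam 0 (Pi.single r (p - pos θ r)) with hf
  have hcont : Continuous f := by
    refine continuous_const.add ?_
    have : Continuous fun p : Pos d => (Pi.single r (p - pos θ r) : Fin k → Pos d) :=
      (continuous_single r).comp (continuous_id.sub continuous_const)
    refine (PiLp.continuous_toLp 2 _).comp (continuous_pi fun i => ?_)
    rcases i with i | ⟨i, j⟩
    · exact continuous_const
    · exact ((EuclideanSpace.proj (𝕜 := ℝ) j).continuous).comp ((continuous_apply i).comp this)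
  have hf0 : f (pos θ r) = θ := by
    ext i
    rcases i with i | ⟨i, j⟩ <;> simp [hf, mkParam]
  have hev : ∀ᶠ p in 𝓝 (pos θ r), f p ∈ U :=
    hcont.continuousAt.eventually_mem (by rw [hf0]; exact hU.mem_nhds hθ)
  filter_upwards [hev] with p hp
  have := hball _ hp r
  simpa [hf] using this

/-! ### The radius of the basin. -/

theorem constC1_mul_constC3_consequence {γ μ q D b normA aMin β : ℝ} (hγ0 : 0 ≤ γ)
    (hK : 1 ≤ 1 + ((k : ℝ) - 1) * μ) (hq : 0 < q)
    (hβ : β ≤ constC1 k d γ μ * constC3 m γ q D aMin b normA) :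
    ((d : ℝ) + 1) * max (b * Real.sqrt m * D) (Real.sqrt (1 + γ) * Real.sqrt q) *
      (Real.sqrt (1 + γ) * Real.sqrt (1 + ((k : ℝ) - 1) * μ) *
        ((Real.sqrt (1 + 2 * q * normA ^ 2) + 1) * β)) ≤
      (1 - γ) * (1 - ((k : ℝ) - 1) * μ) * min 1 (aMin ^ 2 * q / 4) := by
  have h1 : 0 < Real.sqrt (1 + γ) := Real.sqrt_pos.2 (by linarith)
  have h2 : 0 < Real.sqrt (1 + ((k : ℝ) - 1) * μ) := Real.sqrt_pos.2 (by linarith)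
  have h3 : 0 < max (b * Real.sqrt m * D) (Real.sqrt (1 + γ) * Real.sqrt q) :=
    lt_max_of_lt_right (mul_pos h1 (Real.sqrt_pos.2 hq))
  have h4 : 0 ≤ Real.sqrt (1 + 2 * q * normA ^ 2) := Real.sqrt_nonneg _
  unfold constC1 constC3 at hβ
  rw [div_mul_div_comm, le_div_iff₀ (by positivity)] at hβ
  linarith

theorem constC1_mul_constC3_pos {γ μ q D b normA aMin : ℝ} (hγ0 : 0 ≤ γ) (hγ : γ < 1)
    (hK : 1 ≤ 1 + ((k : ℝ) - 1) * μ) (hμ : ((k : ℝ) - 1) * μ < 1) (hq : 0 < q) (ha : 0 < aMin) :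
    0 < constC1 k d γ μ * constC3 m γ q D aMin b normA := by
  have h1 : 0 < Real.sqrt (1 + γ) := Real.sqrt_pos.2 (by linarith)
  have h2 : 0 < Real.sqrt (1 + ((k : ℝ) - 1) * μ) := Real.sqrt_pos.2 (by linarith)
  have h3 : 0 < max (b * Real.sqrt m * D) (Real.sqrt (1 + γ) * Real.sqrt q) :=
    lt_max_of_lt_right (mul_pos h1 (Real.sqrt_pos.2 hq))
  have h4 : 0 ≤ Real.sqrt (1 + 2 * q * normA ^ 2) := Real.sqrt_nonneg _
  have h5 : 0 < 1 - γ := by linarith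
  have h6 : 0 < 1 - ((k : ℝ) - 1) * μ := by linarith
  have h7 : 0 < min 1 (aMin ^ 2 * q / 4) := lt_min one_pos (by positivity)
  unfold constC1 constC3
  positivity

/-- The bound `c ≤ ε/2` alone would let two spikes collide. If `c > ε/4`, the constants give `4√q β
≤ 1 - μ ≤ 1`; hence `16qβ² ≤ (1 - μ)² ≤ 1 - μ ≤ qε²/2` by `one_sub_coherence_le`, so `32β² ≤ ε²`. -/
theorem radius_le_quarter {α : Fin m → Pos d → ℂ} {ρ : ℝ → ℝ} {R ε c μ γ b D normA aMin β : ℝ}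
    (hε : 0 < ε) (hρ : KernelAssumption d ρ ε c) (hμ : MutualCoherence d ρ (ε / 2) μ)
    (hRIP : RIP α ρ (Model k d R (ε / 2)) γ) (hγ0 : 0 ≤ γ)
    (hK : 1 ≤ 1 + ((k : ℝ) - 1) * μ) (hkμ : ((k : ℝ) - 1) * μ < 1) {θ : Param k d}
    (hθ : Admissible R ε θ) {i j : Fin k} (hij : i ≠ j) (hβ0 : 0 < β) (hβc : β ≤ c)
    (hβ : β ≤ constC1 k d γ μ * constC3 m γ |iteratedDeriv 2 ρ 0| D aMin b normA) :
    β ≤ ε / 4 := by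
  rcases le_or_gt c (ε / 4) with hc | hc
  · exact hβc.trans hc
  have hcoh := one_sub_coherence_le hε hρ hμ hRIP hθ.1 hθ.2 hij hc
  have hq : 0 < |iteratedDeriv 2 ρ 0| := abs_pos.2 hρ.deriv2_neg.ne
  have hcons := constC1_mul_constC3_consequence hγ0 hK hq hβ
  set q := |iteratedDeriv 2 ρ 0|
  have hsep := hθ.1 i j hij
  have hμ0 : 0 ≤ μ := (abs_nonneg _).trans
    (hμ.abs_profile_le hρ.value_zero (by linarith) (by linarith : ε / 2 < ‖pos θ i - pos θ j‖))
  have hk2 : (2 : ℝ) ≤ k := by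
    have : 2 ≤ k := by
      have := i.2
      have := j.2
      have := Fin.val_ne_of_ne hij
      omega
    exact_mod_cast this
  have hd1 : (1 : ℝ) ≤ d := by
    rcases Nat.eq_zero_or_pos d with rfl | hd
    · rw [Subsingleton.elim (pos θ i) (pos θ j), sub_self, norm_zero] at hsep
      linarith
    · exact_mod_cast hd
  have hsγ : 1 ≤ Real.sqrt (1 + γ) := Real.one_le_sqrt.2 (by linarith)
  have hsK : 1 ≤ Real.sqrt (1 + ((k : ℝ) - 1) * μ) := Real.one_le_sqrt.2 hK
  have hS : 1 ≤ Real.sqrt (1 + 2 * q * normA ^ 2) :=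
    Real.one_le_sqrt.2 (by linarith [show 0 ≤ 2 * q * normA ^ 2 by positivity])
  have hM : 1 * Real.sqrt q ≤ max (b * Real.sqrt m * D) (Real.sqrt (1 + γ) * Real.sqrt q) :=
    (mul_le_mul_of_nonneg_right hsγ (Real.sqrt_nonneg _)).trans (le_max_right _ _)
  have hlow : (1 + 1) * (1 * Real.sqrt q) * (1 * 1 * ((1 + 1) * β)) ≤
      ((d : ℝ) + 1) * max (b * Real.sqrt m * D) (Real.sqrt (1 + γ) * Real.sqrt q) *
      (Real.sqrt (1 + γ) * Real.sqrt (1 + ((k : ℝ) - 1) * μ) *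
        ((Real.sqrt (1 + 2 * q * normA ^ 2) + 1) * β)) := by
    gcongr
  have hup : (1 - γ) * (1 - ((k : ℝ) - 1) * μ) * min 1 (aMin ^ 2 * q / 4) ≤ 1 * (1 - μ) * 1 := by
    have h1 : 1 - ((k : ℝ) - 1) * μ ≤ 1 - μ := by nlinarith
    have h2 : 0 ≤ 1 - ((k : ℝ) - 1) * μ := by linarith
    have h3 : 0 ≤ min 1 (aMin ^ 2 * q / 4) := le_min zero_le_one (by positivity)
    refine mul_le_mul (mul_le_mul (by linarith) h1 h2 zero_le_one) (min_le_left _ _) h3 ?_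
    linarith
  have hfin : 4 * Real.sqrt q * β ≤ 1 - μ := by linarith
  have hsq : (4 * Real.sqrt q * β) ^ 2 ≤ (1 - μ) ^ 2 :=
    pow_le_pow_left₀ (by positivity) hfin 2
  rw [mul_pow, mul_pow, Real.sq_sqrt hq.le] at hsq
  have h1μ : 0 ≤ 1 - μ := le_trans (by positivity) hfin
  have h2 : q * (32 * β ^ 2) ≤ q * ε ^ 2 := by nlinarith
  have h3 : 32 * β ^ 2 ≤ ε ^ 2 := le_of_mul_le_mul_left h2 hq
  nlinarith

end Spikes

/-! ### Assembly. -/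

theorem corollary4 {k d m : ℕ} (hk : 0 < k) (R ε : ℝ) (hε : 0 < ε)
    -- the measurement operator
    (α : Fin m → Pos d → ℂ)
    (hα : ∀ l, ContDiffOn ℝ 2 (α l) (Metric.closedBall (0 : Pos d) R))
    -- the kernel
    (ρ : ℝ → ℝ) (c μ γ : ℝ)
    (hρ : KernelAssumption d ρ ε c)
    (hμ : MutualCoherence d ρ (ε / 2) μ) (hkμ : ((k : ℝ) - 1) * μ < 1)
    -- the restricted isometry property
    (hRIP : RIP α ρ (Model k d R (ε / 2)) γ) (hγ : γ < 1)
    -- the noisy measurements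
    (x₀ : SpikeMeasure d) (hx₀ : x₀ ∈ Model k d R ε)
    (y e : EuclideanSpace ℂ (Fin m)) (hy : y = measOp α x₀ + e)
    -- the result of the constrained minimization
    (θstar : Param k d) (hmem : θstar ∈ ParamModel k d R ε)
    (hmin : ∀ θ ∈ ParamModel k d R ε, objective α y θstar ≤ objective α y θ)
    (hint : ∀ r, pos θstar r ∈ intrinsicInterior ℝ (Metric.closedBall (0 : Pos d) R))
    (hdist : Function.Injective (pos θstar))
    (hpos : 0 < |amp θstar ⟨0, hk⟩|)
    (hmono : ∀ r s : Fin k, r ≤ s → |amp θstar r| ≤ |amp θstar s|)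
    -- the positions occurring in the ball stay where the measurement functions are given
    (hdom : ∀ θ ∈ Metric.ball θstar (betaMax hk α R ρ c γ μ θstar),
      ∀ r, pos θ r ∈ Metric.closedBall (0 : Pos d) R)
    -- the noise level
    (he : ‖e‖ ≤ Real.sqrt (1 + γ) * Real.sqrt (1 + ((k : ℝ) - 1) * μ) *
      betaMax hk α R ρ c γ μ θstar) :
    IsBasinOfAttraction (objective α y)
      (Metric.ball θstar (betaMax hk α R ρ c γ μ θstar)) θstar := by
  set β := betaMax hk α R ρ c γ μ θstar with hβdef
  set q := |iteratedDeriv 2 ρ 0| with hqdef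
  set a₁ := |amp θstar ⟨0, hk⟩| with ha₁
  set b := |amp θstar ⟨k - 1, Nat.sub_lt hk Nat.one_pos⟩| with hb
  have hq : 0 < q := abs_pos.2 hρ.deriv2_neg.ne
  have ha₁r : ∀ r, a₁ ≤ |amp θstar r| := fun r => hmono _ _ (Fin.mk_le_of_le_val (Nat.zero_le _))
  have hbr : ∀ r, |amp θstar r| ≤ b := fun r =>
    hmono _ _ (Fin.le_def.2 (Nat.le_sub_one_of_lt r.2))
  have hstar : Admissible R ε θstar :=
    ⟨separated_of_mem_paramModel hmem hdist fun r => abs_pos.1 (hpos.trans_le (ha₁r r)),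
      fun r => intrinsicInterior_subset (hint r)⟩
  have hstar2 : ∀ r l, r ≠ l → ε / 2 < ‖pos θstar r - pos θstar l‖ := fun r l h => by
    linarith [hstar.1 r l h]
  have hγ0 : 0 ≤ γ := hRIP.nonneg hρ.value_zero hstar2 hstar.2 ⟨0, hk⟩
  have hK := hμ.one_le_one_add hρ.value_zero (by linarith) hk hstar2
  have hβ0 : 0 < β := lt_min hρ.c_pos (lt_min (by linarith)
    (constC1_mul_constC3_pos hγ0 hγ hK hkμ hq hpos))
  have hβc : β ≤ c := min_le_left _ _
  have hβa : β ≤ a₁ / 2 := (min_le_right _ _).trans (min_le_left _ _)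
  have hβC : β ≤ _ := (min_le_right _ _).trans (min_le_right _ _)
  have hcons := constC1_mul_constC3_consequence hγ0 hK hq hβC
  have hposd : ∀ θ ∈ Metric.ball θstar β, ∀ r, ‖pos θ r - pos θstar r‖ < β := fun θ hθ r =>
    (norm_pos_le_norm (θ - θstar) r).trans_lt (mem_ball_iff_norm.1 hθ)
  have hampd : ∀ θ ∈ Metric.ball θstar β, ∀ r, |amp θ r - amp θstar r| < β := fun θ hθ r =>
    (abs_amp_le_norm (θ - θstar) r).trans_lt (mem_ball_iff_norm.1 hθ)
  have hadm : ∀ θ ∈ Metric.ball θstar β, Admissible R (ε / 2) θ := by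
    refine fun θ hθ => ⟨fun r l hrl => ?_, hdom θ hθ⟩
    have hβε := radius_le_quarter hε hρ hμ hRIP hγ0 hK hkμ hstar hrl hβ0 hβc hβC
    have h1 := norm_sub_le_norm_sub_add_norm_sub (pos θstar r) (pos θ r) (pos θstar l)
    have h2 := norm_sub_le_norm_sub_add_norm_sub (pos θ r) (pos θ l) (pos θstar l)
    rw [norm_sub_rev (pos θstar r) (pos θ r)] at h1
    linarith [hposd θ hθ r, hposd θ hθ l, hstar.1 r l hrl]
  have hnhds : ∀ θ ∈ Metric.ball θstar β, ∀ r, Metric.closedBall (0 : Pos d) R ∈ 𝓝 (pos θ r) :=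
    fun θ hθ r => closedBall_mem_nhds_pos Metric.isOpen_ball hdom hθ r
  have hself : θstar ∈ Metric.ball θstar β := Metric.mem_ball_self hβ0
  -- By closedness of the position ball, smoothness extends to the closed parameter ball, whose
  -- compactness supplies the upper Hessian bound `L`.
  have hclosed : ContDiffOn ℝ 2 (objective α y) (Metric.closedBall θstar β) := by
    refine contDiffOn_objective hα y fun θ hθ r => ?_
    rw [← closure_ball _ hβ0.ne'] at hθ
    exact Metric.isClosed_closedBall.closure_subset_iff.2
      (Set.image_subset_iff.2 fun θ hθ => hdom θ hθ r)
      (image_closure_subset_closure_image (continuous_pos r) ⟨θ, hθ, rfl⟩)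
  obtain ⟨L, hL⟩ := exists_bound_snd_fderiv_of_contDiffOn hclosed (isCompact_closedBall _ _)
    (convex_closedBall _ _) ⟨θstar, by rwa [interior_closedBall _ hβ0.ne']⟩
  rw [interior_closedBall _ hβ0.ne'] at hL
  have hcrit : fderiv ℝ (objective α y) θstar = 0 := by
    refine IsLocalMin.fderiv_eq_zero ?_
    -- Strict separation is an open condition, so the constrained minimizer is an unconstrained
    -- local one.
    have hev : ∀ᶠ θ in 𝓝 θstar, ∀ r l, r ≠ l → ε < ‖pos θ r - pos θ l‖ :=
      eventually_all.2 fun r => eventually_all.2 fun l => eventually_all.2 fun hrl =>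
        ((continuous_pos r).sub (continuous_pos l)).norm.continuousAt.eventually_const_lt
          (hstar.1 r l hrl)
    filter_upwards [hev, Metric.ball_mem_nhds θstar hβ0] with θ h1 h2
    exact hmin θ (phi_mem_model h1 (hdom θ h2))
  have hres : ‖measOp α (phi θstar) - y‖ ≤ ‖e‖ := by
    obtain ⟨θ', hsep, hball, rfl⟩ := hx₀
    have h := hmin θ' (phi_mem_model hsep hball)
    have h2 : measOp α (phi θ') - y = -e := by rw [hy]; abel
    rw [objective, objective, h2, norm_neg] at h
    exact le_of_sq_le_sq h (norm_nonneg _)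
  set M := max (b * Real.sqrt m * derivBound α R) (Real.sqrt (1 + γ) * Real.sqrt q) with hM
  set K := Real.sqrt (1 + γ) * Real.sqrt (1 + ((k : ℝ) - 1) * μ) with hKdef
  set S := Real.sqrt (1 + 2 * q * Real.sqrt (∑ r, amp θstar r ^ 2) ^ 2) with hS
  set G := (1 - γ) * (1 - ((k : ℝ) - 1) * μ) with hG
  have hs : 0 < Real.sqrt (1 + γ) := Real.sqrt_pos.2 (by linarith)
  have hM0 : 0 < M := lt_max_of_lt_right (mul_pos hs (Real.sqrt_pos.2 hq))
  have hK0 : 0 < K := mul_pos hs (Real.sqrt_pos.2 (by linarith))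
  have hS0 : 0 < S := Real.sqrt_pos.2 (by positivity)
  have hG0 : 0 ≤ G := mul_nonneg (by linarith) (by linarith)
  refine ⟨hself, exists_step_gradient_descent_tendsto
    (hclosed.mono Metric.ball_subset_closedBall)
    (fun θ hθ u => (le_abs_self _).trans (hL θ hθ u)) (fun r hr => ?_) hcrit⟩
  -- Here `K * (S * r + β)` bounds the residual at distance `r`. By `hcons` the expression is
  -- nonnegative at `r = β`, hence positive for `r < β`.
  refine ⟨2 * (G * min 1 (a₁ ^ 2 * q / 4) - ((d : ℝ) + 1) * M * (K * (S * r + β))), ?_, ?_⟩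
  · have h1 : S * r + β < (S + 1) * β := by nlinarith
    have h2 : ((d : ℝ) + 1) * M * (K * (S * r + β)) < ((d : ℝ) + 1) * M * (K * ((S + 1) * β)) := by
      gcongr
    linarith
  · intro θ hθr u
    have hθ : θ ∈ Metric.ball θstar β := Metric.closedBall_subset_ball hr hθr
    have hH := le_snd_fderiv_objective hε hα hρ hμ hRIP hγ0 hγ y
      (Filter.eventually_of_mem (Metric.isOpen_ball.mem_nhds hθ) hadm) (hnhds θ hθ) u
    have hlo := sum_quadratic_lower hq.le (θ := θ) (a := a₁) (fun r => by
      have h1 := abs_sub_abs_le_abs_sub (amp θstar r) (amp θ r)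
      rw [abs_sub_comm] at h1
      linarith [ha₁r r, hampd θ hθ r]) (abs_nonneg _) u
    have hup := sum_cross_upper (M := M) (D := Real.sqrt m * derivBound α R) (b := b)
      (P := Real.sqrt (1 + γ) * Real.sqrt q)
      (by rw [← mul_assoc]; exact le_max_left _ _)
      (mul_nonneg (Real.sqrt_nonneg _) (derivBound_nonneg α R)) (le_max_right _ _) (by positivity)
      (θ := θ) (fun r => by
        have h1 := abs_sub_abs_le_abs_sub (amp θ r) (amp θstar r)
        linarith [ha₁r r, hbr r, hampd θ hθ r]) u
    have hdiff := norm_measOp_phi_sub_le hε hρ hμ hRIP hγ0 hK (hadm θ hθ) hstar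
      (fun r => (hposd θ hθ r).le.trans hβc)
      (fun r => by linarith [ha₁r r, hampd θ hθ r])
    have hrθ : ‖measOp α (phi θ) - y‖ ≤ K * (S * r + β) := by
      have h1 := norm_sub_le_norm_sub_add_norm_sub (measOp α (phi θ)) (measOp α (phi θstar)) y
      have h2 : K * (S * ‖θ - θstar‖) ≤ K * (S * r) := by
        gcongr
        exact mem_closedBall_iff_norm.1 hθr
      linarith
    simp only [mul_assoc (Real.sqrt (m : ℝ))] at hup
    have h1 := mul_le_mul_of_nonneg_left hlo hG0
    have h2 : ‖measOp α (phi θ) - y‖ * _ ≤ K * (S * r + β) * (((d : ℝ) + 1) * M * ‖u‖ ^ 2) :=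
      mul_le_mul hrθ hup (Finset.sum_nonneg fun r _ => by
        have := derivBound_nonneg α R
        positivity) ((norm_nonneg _).trans hrθ)
    linarith
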